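/- Let $\mathcal D$ be a triangulated category with Grothendieck group $K(\mathcal D)$, $\Gamma$ a finitely generated free abelian group and $\mathrm{cl}\colon K(\mathcal D)\to\Gamma$ a homomorphism. Homomorphisms $W$ on $\Gamma$ are evaluated on objects by $W(E)=W(\mathrm{cl}(E))$; for $S\subset\Gamma$, $[S]$ is the saturation of the subgroup generated by $S$. Let $(Z,\mathcal A)$ be a very weak stability condition. That is: $\mathcal A$ is the heart of a bounded t-structure on $\mathcal D$; $Z\colon\Gamma\to\mathbb C$ is a homomorphism with $Z(E)\in\{\mathrm{Im}>0\}\cup\mathbb R_{\le 0}$ for all $E\in\mathcal A$; call $E\in\mathcal A$ $\mu$-semistable if $\mu(F)\le\mu(E/F)$ for every non-zero subobject $F\subset E$ in $\mathcal A$, where $\mu=-\mathrm{Re}\,Z/\mathrm{Im}\,Z$ ($=\infty$ if $\mathrm{Im}\,Z=0$); every object of $\mathcal A$ has a Harder–Narasimhan filtration for $\mu$; and, with $\mathcal C=\{E\in\mathcal A: Z(E)=0\}$, $\Gamma_0=[\mathrm{cl}(\mathcal C)]$ and $\overline Z\colon\Gamma/\Gamma_0\to\mathbb C$ induced by $Z$,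 there is a real quadratic form $Q$ on $(\Gamma/\Gamma_0)\otimes\mathbb R$ with $Q(E)\ge 0$ for all $\mu$-semistable $E$, and negative definite on the kernel of $\overline Z$ in $(\Gamma/\Gamma_0)\otimes\mathbb R$. Fix such a $Q$. For $0<\phi\le 1$ let $\mathcal P(\phi)$ consist of $0$ and the $\mu$-semistable objects with $\mu=-1/\tan(\pi\phi)$ (read as $\infty$ for $\phi=1$), put $\mathcal P(\phi+1)=\mathcal P(\phi)[1]$, and let $\mathcal P(I)$ be the extension closure of the $\mathcal P(\phi)$ with $\phi\in I$. Suppose that $(Z,\mathcal A)$ satisfies a BG inequality: there are linear maps $\Delta_R,\Delta_I\colon\Gamma\to\mathbb Q$ such that $\Delta:=\mathrm{Re}\,Z\cdot\Delta_R+\mathrm{Im}\,Z\cdot\Delta_I$ satisfies $\Delta(E)\ge 0$ for all $\mu$-semistable $E\in\mathcal A$, and $\Delta_R|_{\mathcal C}=0$, $\Delta_I|_{\mathcal C}\le 0$, $\Delta_I|_{\mathcal C}\not\equiv 0$. Fix these maps and put $\mathcal C^\dagger=\{F\in\mathcal C:\Delta_I(F)=0\}$, $\Gamma_0^\dagger=\Gamma_0\cap\ker\Delta_I$.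 Suppose that $(Z,\mathcal A)$ is good: (i) $Z(\Gamma)\subset\zeta_1\mathbb Q+\zeta_2\mathbb Q\,i$ for some $\zeta_1,\zeta_2>0$; (ii) $\mathcal A$ is noetherian; (iii) $[\mathrm{cl}(\mathcal C^\dagger)]=\Gamma_0^\dagger$; (iv) for every $\phi\in(0,1)$, each $U\in\mathcal P(\phi)$ admits an injection $U\hookrightarrow\widehat U$ in $\mathcal A$ with $\mathrm{Hom}(\mathcal C^\dagger,\widehat U[1])=0$. Let $\mathcal A^\dagger=\mathcal P((1/2,3/2])$ be the tilted heart and, for $t>0$, let $Z_t^\dagger=-iZ+t\Delta_I$; it induces $\overline Z_t^\dagger$ on $(\Gamma/\Gamma_0^\dagger)\otimes\mathbb R$. Let $\mu_t^\dagger=-\mathrm{Re}\,Z_t^\dagger/\mathrm{Im}\,Z_t^\dagger$ ($=\infty$ if $\mathrm{Im}\,Z_t^\dagger=0$), with $\mu_t^\dagger$-semistability in $\mathcal A^\dagger$ defined as for $\mu$ in $\mathcal A$. Then $\Delta_{k,t}:=kQ+t\Delta$ is a quadratic form on $(\Gamma/\Gamma_0^\dagger)\otimes\mathbb R$, and: (a)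 There is $k_0>0$ such that for all $k\in(0,k_0)$ and all $t>0$ the form $\Delta_{k,t}$ is negative definite on $\ker\overline Z_t^\dagger\subset(\Gamma/\Gamma_0^\dagger)\otimes\mathbb R$. (b) For every $k_0$ as in (a), all $k\in(0,k_0)$, all $t>0$ and every $\mu_t^\dagger$-semistable object $E\in\mathcal A^\dagger$, one has $\Delta_{k,t}(E)=kQ(E)+t\Delta(E)\ge 0$. (c) In particular, $\Delta(E)\ge 0$ for every $t>0$ and every $\mu_t^\dagger$-semistable object $E\in\mathcal A^\dagger$. -/

import Mathlib

open CategoryTheory CategoryTheory.Limits CategoryTheory.Pretriangulated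
open CategoryTheory.Triangulated
open scoped TensorProduct

universe v u w

noncomputable section

namespace VWStab

section Category

variable (D : Type u) [Category.{v} D] [Preadditive D] [HasZeroObject D] [HasShift D ℤ]
  [∀ n : ℤ, (shiftFunctor D n).Additive] [Pretriangulated D]

/-- The relations `[Y] = [X] + [Z]`, one for each distinguished triangle `X ⟶ Y ⟶ Z ⟶ X⟦1⟧`. -/
def K0Relations : AddSubgroup (FreeAbelianGroup D) :=
  AddSubgroup.closure {r | ∃ T : Triangle D, (T ∈ distTriang D) ∧
    r = FreeAbelianGroup.of T.obj₂ - (FreeAbelianGroup.of T.obj₁ + FreeAbelianGroup.of T.obj₃)}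

/-- The Grothendieck group of a triangulated category. -/
abbrev K0 : Type u := FreeAbelianGroup D ⧸ K0Relations D

variable {D}

/-- The class of an object in the Grothendieck group. -/
def K0.of (E : D) : K0 D := QuotientAddGroup.mk (FreeAbelianGroup.of E)

/-- Short exact sequences `0 ⟶ X ⟶ Y ⟶ W ⟶ 0` in a heart `A ⊆ D`: these are exactly the
distinguished triangles of `D` whose three vertices lie in `A`. Thus the subobjects of `Y` in `A`
are the `f : X ⟶ Y` occurring here, and `W` is then the quotient `Y / X`. -/
def IsShortExact (A : ObjectProperty D) {X Y W : D} (f : X ⟶ Y) (g : Y ⟶ W) : Prop :=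
  A X ∧ A Y ∧ A W ∧ ∃ h : W ⟶ X⟦(1 : ℤ)⟧, Triangle.mk f g h ∈ distTriang D

/-- The extension closure `⟨S⟩`: the smallest strictly full subcategory of `D` that contains `S`
and is closed under extensions. -/
inductive ExtClosure (S : ObjectProperty D) : ObjectProperty D
  | of {X : D} (hX : S X) : ExtClosure S X
  | iso {X Y : D} (e : X ≅ Y) (hX : ExtClosure S X) : ExtClosure S Y
  | ext {T : Triangle D} (hT : T ∈ distTriang D) (h₁ : ExtClosure S T.obj₁)
      (h₃ : ExtClosure S T.obj₃) : ExtClosure S T.obj₂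

variable {Γ : Type w} [AddCommGroup Γ]

/-- The value `W(E) = W(cl(E))` on an object of a homomorphism `W` defined on `Γ`. -/
def val {M : Type*} [AddCommGroup M] (cl : K0 D →+ Γ) (W : Γ →ₗ[ℤ] M) (E : D) : M :=
  W (cl (K0.of E))

/-- The slope `- Re W(E) / Im W(E)`, which is `∞` if `Im W(E) = 0`. -/
def slope (cl : K0 D →+ Γ) (W : Γ →ₗ[ℤ] ℂ) (E : D) : EReal :=
  open Classical in
  if (val cl W E).im = 0 then ⊤ else ((-(val cl W E).re / (val cl W E).im : ℝ) : EReal)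

/-- `E ∈ A` is semistable for the slope of `W`: `slope F ≤ slope (E / F)` for all non-zero
subobjects `F` of `E` in `A`. -/
def IsSemistable (A : ObjectProperty D) (cl : K0 D →+ Γ) (W : Γ →ₗ[ℤ] ℂ) (E : D) : Prop :=
  A E ∧ ∀ ⦃F G : D⦄ (f : F ⟶ E) (g : E ⟶ G), IsShortExact A f g → ¬ IsZero F →
    slope cl W F ≤ slope cl W G

/-- `E` has a Harder-Narasimhan filtration `0 = X 0 ⊆ X 1 ⊆ ⋯ ⊆ X n = E` in `A`, whose factors
`F i = X (i + 1) / X i` are semistable of strictly decreasing slopes. -/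
def HasHNFiltration (A : ObjectProperty D) (cl : K0 D →+ Γ) (W : Γ →ₗ[ℤ] ℂ) (E : D) : Prop :=
  ∃ (n : ℕ) (X F : ℕ → D), IsZero (X 0) ∧ X n = E ∧
    (∀ i < n, ∃ (f : X i ⟶ X (i + 1)) (g : X (i + 1) ⟶ F i), IsShortExact A f g) ∧
    (∀ i < n, IsSemistable A cl W (F i)) ∧
    (∀ i, i + 1 < n → slope cl W (F (i + 1)) < slope cl W (F i))

/-- The saturation `[S]` of the subgroup generated by a subset `S` of `Γ`. -/
def saturation (S : Set Γ) : Submodule ℤ Γ where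
  carrier := {x | ∃ n : ℤ, n ≠ 0 ∧ n • x ∈ Submodule.span ℤ S}
  zero_mem' := ⟨1, one_ne_zero, by simp⟩
  add_mem' := by
    rintro a b ⟨n, hn, ha⟩ ⟨m, hm, hb⟩
    refine ⟨n * m, mul_ne_zero hn hm, ?_⟩
    have h : (n * m) • (a + b) = m • (n • a) + n • (m • b) := by
      rw [smul_add, smul_smul, smul_smul, mul_comm m n]
    rw [h]
    exact add_mem (Submodule.smul_mem _ _ ha) (Submodule.smul_mem _ _ hb)
  smul_mem' := by
    rintro c a ⟨n, hn, ha⟩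
    refine ⟨n, hn, ?_⟩
    rw [smul_comm]
    exact Submodule.smul_mem _ _ ha

/-- A homomorphism to a torsion-free group that kills `S` kills the saturation `[S]`. -/
theorem saturation_le_ker {M : Type*} [AddCommGroup M] [Module.IsTorsionFree ℤ M] {S : Set Γ}
    (W : Γ →ₗ[ℤ] M) (h : ∀ x ∈ S, W x = 0) : saturation S ≤ LinearMap.ker W := by
  rintro x ⟨n, hn, hx⟩
  have h1 : Submodule.span ℤ S ≤ LinearMap.ker W := Submodule.span_le.2 h
  have h2 : n • W x = 0 := by simpa using h1 hx
  exact (smul_eq_zero.1 h2).resolve_left hn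

variable (cl : K0 D →+ Γ)

/-- A very weak pre-stability condition `(Z, A)` on `D` with respect to `cl : K(D) → Γ`, where
`A` is the heart of the bounded t-structure `tstr`. -/
structure VeryWeakPreStability where
  tstr : TStructure D
  bounded : ∀ X : D, tstr.bounded X
  Z : Γ →ₗ[ℤ] ℂ
  /-- `Z(E)` lies in the union of the open upper half plane and the ray `ℝ_{≤ 0}`. -/
  Z_mem : ∀ E : D, tstr.heart E →
    0 < (val cl Z E).im ∨ ((val cl Z E).im = 0 ∧ (val cl Z E).re ≤ 0)
  exists_HN : ∀ E : D, tstr.heart E → HasHNFiltration tstr.heart cl Z E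

namespace VeryWeakPreStability

variable {cl} (σ : VeryWeakPreStability cl)

/-- The heart `A`. -/
abbrev A : ObjectProperty D := σ.tstr.heart

/-- The `μ`-semistable objects of `A`, where `μ = - Re Z / Im Z`. -/
def Semistable (E : D) : Prop := IsSemistable σ.A cl σ.Z E

/-- The category `P(φ)` for `0 < φ ≤ 1`: the zero objects and the `μ`-semistable objects of slope
`- 1 / tan (π φ) = - cos (π φ) / sin (π φ)`, read as `∞` for `φ = 1`. -/
def phaseUnit (φ : ℝ) : ObjectProperty D := fun E =>
  IsZero E ∨ (σ.Semistable E ∧ slope cl σ.Z E =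
    open Classical in
    if φ = 1 then ⊤ else ((-(Real.cos (Real.pi * φ) / Real.sin (Real.pi * φ)) : ℝ) : EReal))

/-- The slicing: `P(φ) = P(φ - n)[n]`, where `n` is the integer with `0 < φ - n ≤ 1`. -/
def P (φ : ℝ) : ObjectProperty D := fun E =>
  σ.phaseUnit (φ - (⌈φ⌉ - 1 : ℤ)) (E⟦(-(⌈φ⌉ - 1) : ℤ)⟧)

/-- The category `P(I)`: the extension closure of all the `P(φ)` with `φ ∈ I`. -/
def PInterval (I : Set ℝ) : ObjectProperty D := ExtClosure (fun E => ∃ φ ∈ I, σ.P φ E)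

/-- The tilted heart `A† = P((1/2, 3/2])`. -/
def ADag : ObjectProperty D := σ.PInterval (Set.Ioc (1 / 2) (3 / 2))

/-- The category `𝒞` of the objects `E ∈ A` with `Z(E) = 0`. -/
def C : ObjectProperty D := fun E => σ.A E ∧ val cl σ.Z E = 0

/-- `Γ₀`, the saturation of the subgroup generated by `cl(𝒞)`. -/
def Γ₀ : Submodule ℤ Γ := saturation {x | ∃ E, σ.C E ∧ x = cl (K0.of E)}

theorem Γ₀_le_ker_Z : σ.Γ₀ ≤ LinearMap.ker σ.Z :=
  saturation_le_ker σ.Z (by rintro _ ⟨E, hE, rfl⟩; exact hE.2)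

/-- The real-linear extension of `Z̄ : Γ/Γ₀ → ℂ` to `(Γ/Γ₀) ⊗ ℝ`. -/
def Zbar : (ℝ ⊗[ℤ] (Γ ⧸ σ.Γ₀)) →ₗ[ℝ] ℂ :=
  LinearMap.liftBaseChange ℝ (σ.Γ₀.liftQ σ.Z σ.Γ₀_le_ker_Z)

/-- `Q`, a real quadratic form on `Γ/Γ₀`, gives the support property of `(Z, A)`: it is
non-negative on the classes of `μ`-semistable objects and negative definite on `ker Z̄`. -/
structure IsSupportForm (Q : QuadraticForm ℝ (ℝ ⊗[ℤ] (Γ ⧸ σ.Γ₀))) : Prop where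
  nonneg : ∀ E : D, σ.Semistable E → 0 ≤ Q (1 ⊗ₜ[ℤ] σ.Γ₀.mkQ (cl (K0.of E)))
  neg_def : ∀ x, σ.Zbar x = 0 → x ≠ 0 → Q x < 0

/-- The support property, which makes `(Z, A)` a very weak stability condition. -/
def IsVeryWeakStability : Prop := ∃ Q, σ.IsSupportForm Q

/-- A Bogomolov-Gieseker type inequality for `(Z, A)`. -/
structure BGInequality where
  ΔR : Γ →ₗ[ℤ] ℚ
  ΔI : Γ →ₗ[ℤ] ℚ
  nonneg : ∀ E : D, σ.Semistable E →
    0 ≤ (val cl σ.Z E).re * ((val cl ΔR E : ℚ) : ℝ) + (val cl σ.Z E).im * ((val cl ΔI E : ℚ) : ℝ)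
  ΔR_C : ∀ E : D, σ.C E → val cl ΔR E = 0
  ΔI_C : ∀ E : D, σ.C E → val cl ΔI E ≤ 0
  ΔI_C_ne : ∃ E : D, σ.C E ∧ val cl ΔI E ≠ 0

namespace BGInequality

variable {σ} (B : σ.BGInequality)

/-- The quadratic function `Δ = Re Z · ΔR + Im Z · ΔI` on `Γ`. -/
def Δ (x : Γ) : ℝ := (σ.Z x).re * (B.ΔR x : ℝ) + (σ.Z x).im * (B.ΔI x : ℝ)

/-- `ΔI` with values in `ℂ`. -/
def ΔIComplex : Γ →ₗ[ℤ] ℂ := (Rat.castHom ℂ).toIntAlgHom.toLinearMap ∘ₗ B.ΔI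

/-- The homomorphism `Z†_t = - i Z + t ΔI`. -/
def ZDag (t : ℝ) : Γ →ₗ[ℤ] ℂ :=
  LinearMap.mulLeft ℤ (-Complex.I) ∘ₗ σ.Z + LinearMap.mulLeft ℤ (t : ℂ) ∘ₗ B.ΔIComplex

theorem ZDag_apply (t : ℝ) (x : Γ) :
    B.ZDag t x = -Complex.I * σ.Z x + (t : ℂ) * ((B.ΔI x : ℚ) : ℂ) := rfl

/-- The `μ†_t`-semistable objects of `A†`, where `μ†_t = - Re Z†_t / Im Z†_t`. -/
def DagSemistable (t : ℝ) (E : D) : Prop := IsSemistable σ.ADag cl (B.ZDag t) E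

/-- The category `𝒞†` of the objects `F ∈ 𝒞` with `ΔI(F) = 0`. -/
def CDag : ObjectProperty D := fun F => σ.C F ∧ val cl B.ΔI F = 0

/-- `Γ₀† = Γ₀ ∩ ker ΔI`. -/
def Γ₀Dag : Submodule ℤ Γ := σ.Γ₀ ⊓ LinearMap.ker B.ΔI

/-- `(Z, A)` is good. -/
structure IsGood : Prop where
  veryWeakStability : σ.IsVeryWeakStability
  rational : ∃ ζ₁ ζ₂ : ℝ, 0 < ζ₁ ∧ 0 < ζ₂ ∧ ∀ x : Γ, ∃ a b : ℚ,
    σ.Z x = ((ζ₁ * a : ℝ) : ℂ) + ((ζ₂ * b : ℝ) : ℂ) * Complex.I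
  noetherian : ∀ E : σ.A.FullSubcategory, IsNoetherianObject E
  saturation_CDag : saturation {x | ∃ F, B.CDag F ∧ x = cl (K0.of F)} = B.Γ₀Dag
  exists_hull : ∀ φ ∈ Set.Ioo (0 : ℝ) 1, ∀ U : D, σ.P φ U →
    ∃ (Uhat W : D) (f : U ⟶ Uhat) (g : Uhat ⟶ W), IsShortExact σ.A f g ∧
      ∀ F : D, B.CDag F → ∀ h : F ⟶ Uhat⟦(1 : ℤ)⟧, h = 0

theorem Γ₀Dag_le_ker_Z : B.Γ₀Dag ≤ LinearMap.ker σ.Z := inf_le_left.trans σ.Γ₀_le_ker_Z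

theorem Γ₀Dag_le_ker_ΔI : B.Γ₀Dag ≤ LinearMap.ker B.ΔI := inf_le_right

theorem Γ₀Dag_le_ker_ΔR : B.Γ₀Dag ≤ LinearMap.ker B.ΔR :=
  inf_le_left.trans (saturation_le_ker B.ΔR (by rintro _ ⟨E, hE, rfl⟩; exact B.ΔR_C E hE))

theorem Γ₀Dag_le_ker_ZDag (t : ℝ) : B.Γ₀Dag ≤ LinearMap.ker (B.ZDag t) := by
  intro x hx
  have h1 : σ.Z x = 0 := B.Γ₀Dag_le_ker_Z hx
  have h2 : B.ΔI x = 0 := B.Γ₀Dag_le_ker_ΔI hx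
  rw [LinearMap.mem_ker, ZDag_apply, h1, h2]
  simp

/-- The real vector space `(Γ/Γ₀†) ⊗ ℝ`. -/
abbrev VDag : Type w := ℝ ⊗[ℤ] (Γ ⧸ B.Γ₀Dag)

/-- The class of an object in `Γ/Γ₀† ⊆ (Γ/Γ₀†) ⊗ ℝ`. -/
def clDag (E : D) : B.VDag := 1 ⊗ₜ[ℤ] B.Γ₀Dag.mkQ (cl (K0.of E))

/-- The real-linear extension of `Z̄†_t : Γ/Γ₀† → ℂ`. -/
def ZDagBar (t : ℝ) : B.VDag →ₗ[ℝ] ℂ :=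
  LinearMap.liftBaseChange ℝ (B.Γ₀Dag.liftQ (B.ZDag t) (B.Γ₀Dag_le_ker_ZDag t))

/-- The real-linear extension of the map `Γ/Γ₀† → ℂ` induced by `Z`. -/
def ZVDag : B.VDag →ₗ[ℝ] ℂ :=
  LinearMap.liftBaseChange ℝ (B.Γ₀Dag.liftQ σ.Z B.Γ₀Dag_le_ker_Z)

/-- The real-linear extension of a map `Γ/Γ₀† → ℚ` induced by a map `L : Γ → ℚ`. -/
def ratVDag (L : Γ →ₗ[ℤ] ℚ) (hL : B.Γ₀Dag ≤ LinearMap.ker L) : B.VDag →ₗ[ℝ] ℝ :=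
  LinearMap.liftBaseChange ℝ ((Rat.castHom ℝ).toIntAlgHom.toLinearMap ∘ₗ B.Γ₀Dag.liftQ L hL)

/-- The quadratic form induced by `Δ = Re Z · ΔR + Im Z · ΔI` on `Γ/Γ₀†`. -/
def ΔForm : QuadraticForm ℝ B.VDag :=
  QuadraticMap.linMulLin (Complex.reLm ∘ₗ B.ZVDag) (B.ratVDag B.ΔR B.Γ₀Dag_le_ker_ΔR) +
    QuadraticMap.linMulLin (Complex.imLm ∘ₗ B.ZVDag) (B.ratVDag B.ΔI B.Γ₀Dag_le_ker_ΔI)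

/-- The projection `(Γ/Γ₀†) ⊗ ℝ → (Γ/Γ₀) ⊗ ℝ`. -/
def projDag : B.VDag →ₗ[ℝ] ℝ ⊗[ℤ] (Γ ⧸ σ.Γ₀) :=
  (Submodule.factor (inf_le_left : B.Γ₀Dag ≤ σ.Γ₀)).baseChange ℝ

/-- The quadratic form `Δ_{k,t} = k Q + t Δ` on `Γ/Γ₀†`. -/
def Δkt (Q : QuadraticForm ℝ (ℝ ⊗[ℤ] (Γ ⧸ σ.Γ₀))) (k t : ℝ) : QuadraticForm ℝ B.VDag :=
  k • Q.comp B.projDag + t • B.ΔForm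

theorem Δkt_clDag (Q : QuadraticForm ℝ (ℝ ⊗[ℤ] (Γ ⧸ σ.Γ₀))) (k t : ℝ) (E : D) :
    B.Δkt Q k t (B.clDag E) =
      k * Q (1 ⊗ₜ[ℤ] σ.Γ₀.mkQ (cl (K0.of E))) + t * B.Δ (cl (K0.of E)) := by
  simp [Δkt, clDag, ΔForm, projDag, ZVDag, ratVDag, Δ, mul_add]
  exact Or.inl rfl

/-- `Δ_{k,t}` is negative definite on `ker Z̄†_t` for all `k ∈ (0, k₀)` and `t > 0`. -/
def NegDefBelow (Q : QuadraticForm ℝ (ℝ ⊗[ℤ] (Γ ⧸ σ.Γ₀))) (k₀ : ℝ) : Prop :=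
  ∀ k ∈ Set.Ioo 0 k₀, ∀ t : ℝ, 0 < t →
    ∀ x : B.VDag, B.ZDagBar t x = 0 → x ≠ 0 → B.Δkt Q k t x < 0

end BGInequality

end VeryWeakPreStability

end Category

end VWStab

end

/-! For fixed `m = k / t` one has `Δ_{k,t} = t (m Q + Δ)`, so up to a positive factor the form is `q
= m Q + Δ`, independent of the parameter. Part (a) makes `q` negative definite on `ker Z†_s` for
every `s > 0` with `m s < k₀`, in particular for all `s ≤ t`. This permits wall-crossing towards `s
= 0`, by induction on `rk = -Re Z = Im Z†_s`. This rank is non-negative on the tilted heart and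
takes values in some `δℤ`, because `Z` is rational and `Γ` is finitely generated.

In rank 0, `Q ≥ 0` and `Δ ≥ 0` are read off from the generators of the tilted heart. If `E` of
positive rank stays semistable for all small `s`, the limit `s → 0` compares it with the first
Harder-Narasimhan factor of `E`, or of `H⁻¹(E)`. This forces the class of `E` to be, up to sign and
a class killed by `Z`, that of a `μ`-semistable object, so the BG inequality and the support
property apply (`nonneg_of_forall_weakSemistable`). Otherwise there is a last wall `t₁`. Local
finiteness of walls (`exists_wall`) yields a subobject and a quotient of smaller positive rank with
the same `Z†_{t₁}`-phase, both semistable. Both have `q ≥ 0` by induction, and negative definiteness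
on `ker Z†_{t₁}` gives `q ≥ 0` for their sum (`quadraticForm_add_nonneg`).

For (a): on `ker Z†_t` one has `t Δ = -(Im Z)²`, while `Q ≤ K (Im Z)²` where `Re Z = 0`, so `k₀ = 1
/ K` works. Part (c) is the limit `k → 0` of (b). -/

open scoped ZeroObject

namespace VWStab

/-! ### Triangles, extension closures and the octahedral axiom. -/

section Triangles

variable {D : Type u} [Category.{v} D] [Preadditive D] [HasZeroObject D] [HasShift D ℤ]
  [∀ n : ℤ, (shiftFunctor D n).Additive] [Pretriangulated D]

theorem K0.of_triangle {X Y W : D} {f : X ⟶ Y} {g : Y ⟶ W} {h : W ⟶ X⟦(1 : ℤ)⟧}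
    (hT : Triangle.mk f g h ∈ distTriang D) : K0.of Y = K0.of X + K0.of W := by
  have h1 : FreeAbelianGroup.of Y - (FreeAbelianGroup.of X + FreeAbelianGroup.of W) ∈
      K0Relations D := AddSubgroup.subset_closure ⟨_, hT, rfl⟩
  have h2 := (QuotientAddGroup.eq_zero_iff _).2 h1
  rw [QuotientAddGroup.mk_sub, sub_eq_zero] at h2
  exact h2

theorem K0.of_isZero {X : D} (hX : IsZero X) : K0.of X = 0 := by
  have h := K0.of_triangle (f := 𝟙 X) (g := 𝟙 X) (h := (0 : X ⟶ X⟦(1 : ℤ)⟧))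
    ((Triangle.distinguished_iff_of_isZero₃ _ hX).2 (inferInstanceAs (IsIso (𝟙 X))))
  simpa using h

theorem triangle_of_iso {X Y : D} (e : X ≅ Y) :
    Triangle.mk e.hom (0 : Y ⟶ (0 : D)) 0 ∈ distTriang D :=
  (Triangle.distinguished_iff_of_isZero₃ _ (isZero_zero D)).2 (inferInstanceAs (IsIso e.hom))

theorem K0.of_iso {X Y : D} (e : X ≅ Y) : K0.of X = K0.of Y := by
  rw [K0.of_triangle (triangle_of_iso e), K0.of_isZero (isZero_zero D), add_zero]

theorem K0.of_shift (X : D) : K0.of (X⟦(1 : ℤ)⟧) = -K0.of X := by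
  have h := K0.of_triangle (rot_of_distTriang _ (contractible_distinguished X))
  have h0 : K0.of (0 : D) = 0 := K0.of_isZero (isZero_zero D)
  have h' : K0.of (0 : D) = K0.of X + K0.of (X⟦(1 : ℤ)⟧) := h
  rw [h0] at h'
  exact (neg_eq_of_add_eq_zero_right h'.symm).symm

theorem ExtClosure.mono {S S' : ObjectProperty D} (h : ∀ X, S X → ExtClosure S' X) {X : D}
    (hX : ExtClosure S X) : ExtClosure S' X := by
  induction hX with
  | of hX => exact h _ hX
  | iso e _ ih => exact .iso e ih
  | ext hT _ _ ih₁ ih₃ => exact .ext hT ih₁ ih₃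

theorem ExtClosure.mk_ext {S : ObjectProperty D} {X Y W : D} {f : X ⟶ Y} {g : Y ⟶ W}
    {h : W ⟶ X⟦(1 : ℤ)⟧} (hT : Triangle.mk f g h ∈ distTriang D) (hX : ExtClosure S X)
    (hW : ExtClosure S W) : ExtClosure S Y :=
  ExtClosure.ext hT hX hW

theorem ExtClosure.hom_eq_zero_left {S : ObjectProperty D} {Y : D}
    (h : ∀ X, S X → ∀ f : X ⟶ Y, f = 0) {X : D} (hX : ExtClosure S X) (f : X ⟶ Y) : f = 0 := by
  induction hX with
  | of hX => exact h _ hX f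
  | iso e _ ih => rw [← cancel_epi e.hom, ih (e.hom ≫ f), comp_zero]
  | @ext T hT _ _ ih₁ ih₃ =>
    obtain ⟨g, rfl⟩ := T.yoneda_exact₂ hT f (ih₁ _)
    rw [ih₃ g, comp_zero]

theorem ExtClosure.hom_eq_zero_right {S : ObjectProperty D} {X : D}
    (h : ∀ Y, S Y → ∀ f : X ⟶ Y, f = 0) {Y : D} (hY : ExtClosure S Y) (f : X ⟶ Y) : f = 0 := by
  induction hY with
  | of hY => exact h _ hY f
  | iso e _ ih => rw [← cancel_mono e.inv, ih (f ≫ e.inv), zero_comp]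
  | @ext T hT _ _ ih₁ ih₃ =>
    obtain ⟨g, rfl⟩ := T.coyoneda_exact₂ hT f (ih₃ _)
    rw [ih₁ g, zero_comp]

theorem ExtClosure.shift {S : ObjectProperty D} {X : D} (hX : ExtClosure S X) :
    ExtClosure (fun Y => ∃ U, S U ∧ Nonempty (U⟦(1 : ℤ)⟧ ≅ Y)) (X⟦(1 : ℤ)⟧) := by
  induction hX with
  | @of X hX => exact .of ⟨X, hX, ⟨Iso.refl _⟩⟩
  | iso e _ ih => exact .iso ((shiftFunctor D (1 : ℤ)).mapIso e) ih
  | @ext T hT _ _ ih₁ ih₃ => exact .ext (T.shift_distinguished hT 1) ih₁ ih₃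

variable [IsTriangulated D]

/-- The octahedral axiom as the third isomorphism theorem: for `F' ⊆ F ⊆ E`, the object `C = E/F'`
is an extension of `E/F` by `F/F'`. -/
theorem exists_triangle_of_comp_left {F' F F'' E G : D}
    {a : F' ⟶ F} {b : F ⟶ F''} {c : F'' ⟶ F'⟦(1 : ℤ)⟧} (h₁ : Triangle.mk a b c ∈ distTriang D)
    {f : F ⟶ E} {g : E ⟶ G} {h : G ⟶ F⟦(1 : ℤ)⟧} (h₂ : Triangle.mk f g h ∈ distTriang D) :
    ∃ (C : D) (p : E ⟶ C) (q : C ⟶ F'⟦(1 : ℤ)⟧) (i : F'' ⟶ C) (j : C ⟶ G)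
      (k : G ⟶ F''⟦(1 : ℤ)⟧), Triangle.mk (a ≫ f) p q ∈ distTriang D ∧
      Triangle.mk i j k ∈ distTriang D := by
  obtain ⟨C, p, q, h₃⟩ := distinguished_cocone_triangle (a ≫ f)
  exact ⟨C, p, q, _, _, _, h₃, (someOctahedron rfl h₁ h₂ h₃).mem⟩

/-- The octahedral axiom again: `K` plays the role of the preimage in `E` of `G' ⊆ G = E/F`. -/
theorem exists_triangle_of_comp_right {F E G G' G'' : D}
    {f : F ⟶ E} {g : E ⟶ G} {h : G ⟶ F⟦(1 : ℤ)⟧} (h₁ : Triangle.mk f g h ∈ distTriang D)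
    {a : G' ⟶ G} {b : G ⟶ G''} {c : G'' ⟶ G'⟦(1 : ℤ)⟧} (h₂ : Triangle.mk a b c ∈ distTriang D) :
    ∃ (K : D) (p : K ⟶ E) (q : G'' ⟶ K⟦(1 : ℤ)⟧) (i : F ⟶ K) (j : K ⟶ G')
      (k : G' ⟶ F⟦(1 : ℤ)⟧), Triangle.mk p (g ≫ b) q ∈ distTriang D ∧
      Triangle.mk i j k ∈ distTriang D ∧ i ≫ p = f := by
  obtain ⟨K, p, q, h₃⟩ := distinguished_cocone_triangle₁ (g ≫ b)
  exact ⟨K, p, q, _, _, _, h₃, (someOctahedron' rfl h₁ h₂ h₃).mem,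
    (someOctahedron' rfl h₁ h₂ h₃).comm₁⟩

end Triangles

/-! ### The heart of a t-structure as an exact category. -/

section Heart

variable {D : Type u} [Category.{v} D] [Preadditive D] [HasZeroObject D] [HasShift D ℤ]
  [∀ n : ℤ, (shiftFunctor D n).Additive] [Pretriangulated D] (t : TStructure D)

theorem heart_hom_shift_eq_zero {X Y : D} (hX : t.heart X) (hY : t.heart Y)
    (f : X⟦(1 : ℤ)⟧ ⟶ Y) : f = 0 := by
  obtain ⟨_, _⟩ := (t.mem_heart_iff X).1 hX
  obtain ⟨_, _⟩ := (t.mem_heart_iff Y).1 hY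
  have := t.isLE_shift X 0 1 (-1)
  exact t.zero f (-1) 0

theorem heart_ext {X Y W : D} {f : X ⟶ Y} {g : Y ⟶ W} {h : W ⟶ X⟦(1 : ℤ)⟧}
    (hT : Triangle.mk f g h ∈ distTriang D) (hX : t.heart X) (hW : t.heart W) : t.heart Y := by
  rw [t.mem_heart_iff] at *
  exact ⟨t.isLE₂ _ hT 0 hX.1 hW.1, t.isGE₂ _ hT 0 hX.2 hW.2⟩

theorem heart_of_isZero {X : D} (hX : IsZero X) : t.heart X := by
  rw [t.mem_heart_iff]
  exact ⟨t.isLE_of_isZero hX 0, t.isGE_of_isZero hX 0⟩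

/-- If the first map is zero, `h` is a split epimorphism. Its section `X[1] ⟶ W` vanishes because
there are no negative extensions in the heart, so the identity of `X[1]` is zero. -/
theorem isZero_of_mono_zero {X Y W : D} {g : Y ⟶ W} {h : W ⟶ X⟦(1 : ℤ)⟧}
    (hT : Triangle.mk (0 : X ⟶ Y) g h ∈ distTriang D) (hX : t.heart X) (hW : t.heart W) :
    IsZero X := by
  have h1 : Epi h := Triangle.epi₃ _ hT rfl
  have h2 : IsSplitEpi h := isSplitEpi_of_epi h
  obtain ⟨s, hs⟩ := h2.exists_splitEpi
  rw [heart_hom_shift_eq_zero t hX hW s, zero_comp] at hs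
  rw [IsZero.iff_id_eq_zero]
  apply (shiftFunctor D (1 : ℤ)).map_injective
  rw [CategoryTheory.Functor.map_id, Functor.map_zero]
  exact hs.symm

theorem isZero_of_epi_zero {X Y W : D} {f : X ⟶ Y} {h : W ⟶ X⟦(1 : ℤ)⟧}
    (hT : Triangle.mk f (0 : Y ⟶ W) h ∈ distTriang D) (hX : t.heart X) (hW : t.heart W) :
    IsZero W := by
  have h1 : Mono h := Triangle.mono₃ _ hT rfl
  have h2 : IsSplitMono h := isSplitMono_of_mono h
  obtain ⟨s, hs⟩ := h2.exists_splitMono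
  rw [heart_hom_shift_eq_zero t hX hW s, comp_zero] at hs
  rw [IsZero.iff_id_eq_zero]
  exact hs.symm

variable [IsTriangulated D]

/-- The cone of `f` has cohomology only in degrees `-1` and `0`. These are the kernel (shifted) and
the cokernel of `f`, and the octahedron on the truncation triangle produces the image. -/
theorem exists_image {X Y : D} (hX : t.heart X) (hY : t.heart Y) (f : X ⟶ Y) :
    ∃ (K I Q : D) (i : K ⟶ X) (p : X ⟶ I) (d : I ⟶ K⟦(1 : ℤ)⟧) (j : I ⟶ Y) (q : Y ⟶ Q)
      (e : Q ⟶ I⟦(1 : ℤ)⟧), t.heart K ∧ t.heart I ∧ t.heart Q ∧ p ≫ j = f ∧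
      Triangle.mk i p d ∈ distTriang D ∧ Triangle.mk j q e ∈ distTriang D := by
  obtain ⟨_, _⟩ := (t.mem_heart_iff X).1 hX
  obtain ⟨_, _⟩ := (t.mem_heart_iff Y).1 hY
  obtain ⟨C, g, h, hC⟩ := distinguished_cocone_triangle f
  obtain ⟨K, Q, hK, hQ, a, b, c, hT⟩ := t.exists_triangle C (-1) 0 (by lia)
  have hK' : t.IsLE K (-1) := ⟨hK⟩
  have hQ' : t.IsGE Q 0 := ⟨hQ⟩
  have hX1 : t.IsLE (X⟦(1 : ℤ)⟧) (-1) := t.isLE_shift X 0 1 (-1)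
  have hX1' : t.IsGE (X⟦(1 : ℤ)⟧) (-1) := t.isGE_shift X 0 1 (-1)
  have hK1 : t.IsLE (K⟦(1 : ℤ)⟧) (-2) := t.isLE_shift K (-1) 1 (-2)
  have hQ1 : t.IsGE (Q⟦(-1 : ℤ)⟧) 1 := t.isGE_shift Q 0 (-1) 1
  have hCle : t.IsLE C 0 := t.isLE₂ _ (rot_of_distTriang _ hC) 0 ‹_›
    (t.isLE_of_le (X⟦(1 : ℤ)⟧) (-1) 0)
  have hCge : t.IsGE C (-1) := t.isGE₂ _ (rot_of_distTriang _ hC) (-1)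
    (t.isGE_of_ge Y (-1) 0) hX1'
  have hQle : t.IsLE Q 0 := t.isLE₂ _ (rot_of_distTriang _ hT) 0 hCle
    (t.isLE_of_le (K⟦(1 : ℤ)⟧) (-2) 0)
  have hKge : t.IsGE K (-1) := t.isGE₂ _ (inv_rot_of_distTriang _ hT) (-1)
    (t.isGE_of_ge (Q⟦(-1 : ℤ)⟧) (-1) 1) hCge
  obtain ⟨I, j, e, p, d, d', h1, h2, h3⟩ := exists_triangle_of_comp_right hC hT
  have hIle : t.IsLE I 0 := t.isLE₂ _ h2 0 ‹_› (t.isLE_of_le K (-1) 0)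
  have hIge : t.IsGE I 0 := t.isGE₂ _ (inv_rot_of_distTriang _ h1) 0
    (t.isGE_of_ge (Q⟦(-1 : ℤ)⟧) 0 1) ‹_›
  refine ⟨K⟦(-1 : ℤ)⟧, I, Q, _, p, _, j, _, e, ?_, (t.mem_heart_iff I).2 ⟨hIle, hIge⟩,
    (t.mem_heart_iff Q).2 ⟨hQle, hQ'⟩, h3, inv_rot_of_distTriang _ h2, h1⟩
  exact (t.mem_heart_iff _).2 ⟨t.isLE_shift K (-1) (-1) 0, t.isGE_shift K (-1) (-1) 0⟩

end Heart

end VWStab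

/-! ### Slopes and semistable objects. -/

namespace VWStab

theorem triangle_of_iso_obj₁ {D : Type u} [Category.{v} D] [Preadditive D] [HasZeroObject D]
    [HasShift D ℤ] [∀ n : ℤ, (shiftFunctor D n).Additive] [Pretriangulated D]
    {X X' Y W : D} {f : X ⟶ Y} {g : Y ⟶ W} {h : W ⟶ X⟦(1 : ℤ)⟧}
    (hT : Triangle.mk f g h ∈ distTriang D) (e : X' ≅ X) :
    Triangle.mk (e.hom ≫ f) g (h ≫ e.inv⟦(1 : ℤ)⟧') ∈ distTriang D := by
  refine isomorphic_distinguished _ hT _ (Triangle.isoMk _ _ e (Iso.refl _) (Iso.refl _) ?_ ?_ ?_)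
  · exact Category.comp_id _
  · exact (Category.comp_id _).trans (Category.id_comp _).symm
  · change (h ≫ e.inv⟦(1 : ℤ)⟧') ≫ e.hom⟦(1 : ℤ)⟧' = 𝟙 W ≫ h
    rw [Category.assoc, ← Functor.map_comp, e.inv_hom_id, CategoryTheory.Functor.map_id,
      Category.comp_id, Category.id_comp]

theorem triangle_of_iso_obj₂ {D : Type u} [Category.{v} D] [Preadditive D] [HasZeroObject D]
    [HasShift D ℤ] [∀ n : ℤ, (shiftFunctor D n).Additive] [Pretriangulated D]
    {X Y Y' W : D} {f : X ⟶ Y} {g : Y ⟶ W} {h : W ⟶ X⟦(1 : ℤ)⟧}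
    (hT : Triangle.mk f g h ∈ distTriang D) (e : Y ≅ Y') :
    Triangle.mk (f ≫ e.hom) (e.inv ≫ g) h ∈ distTriang D := by
  refine isomorphic_distinguished _ hT _
    (Triangle.isoMk _ _ (Iso.refl _) e.symm (Iso.refl _) ?_ ?_ ?_)
  · change (f ≫ e.hom) ≫ e.inv = 𝟙 X ≫ f
    simp
  · exact Category.comp_id _
  · change h ≫ (𝟙 X)⟦(1 : ℤ)⟧' = 𝟙 W ≫ h
    simp

/-- The slope `- Re z / Im z` of a complex number. -/
noncomputable def slopeOf (z : ℂ) : EReal :=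
  open Classical in if z.im = 0 then ⊤ else ((-z.re / z.im : ℝ) : EReal)

theorem slopeOf_of_im_eq_zero {z : ℂ} (h : z.im = 0) : slopeOf z = ⊤ := if_pos h

theorem slopeOf_of_im_ne_zero {z : ℂ} (h : z.im ≠ 0) :
    slopeOf z = ((-z.re / z.im : ℝ) : EReal) := if_neg h

theorem slopeOf_eq_top_iff {z : ℂ} : slopeOf z = ⊤ ↔ z.im = 0 := by
  by_cases h : z.im = 0
  · simp [slopeOf_of_im_eq_zero h, h]
  · simp [slopeOf_of_im_ne_zero h, h]

theorem slopeOf_le_slopeOf_iff {z w : ℂ} (hz : 0 < z.im) (hw : 0 < w.im) :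
    slopeOf z ≤ slopeOf w ↔ z.im * w.re ≤ w.im * z.re := by
  rw [slopeOf_of_im_ne_zero hz.ne', slopeOf_of_im_ne_zero hw.ne', EReal.coe_le_coe_iff,
    div_le_div_iff₀ hz hw]
  constructor <;> intro h <;> linarith

theorem slopeOf_add_le_right {z w : ℂ} (hz : 0 ≤ z.im) (hw : 0 ≤ w.im)
    (h : slopeOf z ≤ slopeOf w) : slopeOf (z + w) ≤ slopeOf w := by
  rcases hw.eq_or_lt with hw | hw
  · rw [slopeOf_of_im_eq_zero hw.symm]; exact le_top
  rcases hz.eq_or_lt with hz | hz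
  · rw [slopeOf_of_im_eq_zero hz.symm, top_le_iff, slopeOf_eq_top_iff] at h
    exact absurd h hw.ne'
  rw [slopeOf_le_slopeOf_iff hz hw] at h
  rw [slopeOf_le_slopeOf_iff (by simp only [Complex.add_im]; linarith) hw]
  simp only [Complex.add_im, Complex.add_re]
  linarith

/-- `hw'` is needed because a summand on the positive real axis has slope `⊤` but lowers the slope
of the sum. -/
theorem slopeOf_left_le_add {z w : ℂ} (hz : 0 ≤ z.im) (hw : 0 ≤ w.im)
    (hw' : w.im = 0 → w.re ≤ 0) (h : slopeOf z ≤ slopeOf w) :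
    slopeOf z ≤ slopeOf (z + w) := by
  rcases hz.eq_or_lt with hz | hz
  · rw [slopeOf_of_im_eq_zero hz.symm, top_le_iff, slopeOf_eq_top_iff] at h
    rw [slopeOf_of_im_eq_zero (z := z + w) (by simp [← hz, h])]
    exact le_top
  have hzw : 0 < (z + w).im := by simp only [Complex.add_im]; linarith
  rw [slopeOf_le_slopeOf_iff hz hzw]
  simp only [Complex.add_im, Complex.add_re]
  rcases hw.eq_or_lt with hw | hw
  · have := hw' hw.symm
    rw [← hw]; nlinarith
  · rw [slopeOf_le_slopeOf_iff hz hw] at h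
    linarith

section

variable {D : Type u} [Category.{v} D] [Preadditive D] [HasZeroObject D] [HasShift D ℤ]
  [∀ n : ℤ, (shiftFunctor D n).Additive] [Pretriangulated D]
  {Γ : Type w} [AddCommGroup Γ] {cl : K0 D →+ Γ}

theorem slope_eq_slopeOf (W : Γ →ₗ[ℤ] ℂ) (E : D) : slope cl W E = slopeOf (val cl W E) := rfl

theorem val_triangle {M : Type*} [AddCommGroup M] (W : Γ →ₗ[ℤ] M) {X Y V : D} {f : X ⟶ Y}
    {g : Y ⟶ V} {h : V ⟶ X⟦(1 : ℤ)⟧} (hT : Triangle.mk f g h ∈ distTriang D) :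
    val cl W Y = val cl W X + val cl W V := by
  simp [val, K0.of_triangle hT]

theorem val_isZero {M : Type*} [AddCommGroup M] (W : Γ →ₗ[ℤ] M) {X : D} (hX : IsZero X) :
    val cl W X = 0 := by
  simp [val, K0.of_isZero hX]

theorem val_iso {M : Type*} [AddCommGroup M] (W : Γ →ₗ[ℤ] M) {X Y : D} (e : X ≅ Y) :
    val cl W X = val cl W Y := by
  simp [val, K0.of_iso e]

theorem slope_isZero (W : Γ →ₗ[ℤ] ℂ) {X : D} (hX : IsZero X) : slope cl W X = ⊤ := by
  rw [slope_eq_slopeOf, val_isZero W hX]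
  exact slopeOf_of_im_eq_zero rfl

theorem slope_iso (W : Γ →ₗ[ℤ] ℂ) {X Y : D} (e : X ≅ Y) : slope cl W X = slope cl W Y := by
  rw [slope_eq_slopeOf, slope_eq_slopeOf, val_iso W e]

theorem IsSemistable.of_iso {A : ObjectProperty D} [A.IsClosedUnderIsomorphisms]
    {W : Γ →ₗ[ℤ] ℂ} {X Y : D} (hX : IsSemistable A cl W X) (e : X ≅ Y) :
    IsSemistable A cl W Y := by
  refine ⟨A.prop_of_iso e hX.1, ?_⟩
  rintro F G f g ⟨hF, -, hG, h, hT⟩ hF0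
  exact hX.2 (f ≫ e.inv) (e.hom ≫ g) ⟨hF, hX.1, hG, h, triangle_of_iso_obj₂ hT e.symm⟩ hF0

namespace VeryWeakPreStability

variable (σ : VeryWeakPreStability cl)

theorem im_nonneg {E : D} (hE : σ.A E) : 0 ≤ (val cl σ.Z E).im := by
  rcases σ.Z_mem E hE with h | h
  · exact h.le
  · exact h.1.ge

theorem re_nonpos {E : D} (hE : σ.A E) (h : (val cl σ.Z E).im = 0) :
    (val cl σ.Z E).re ≤ 0 := by
  rcases σ.Z_mem E hE with h' | h'
  · exact absurd h h'.ne'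
  · exact h'.2

theorem semistable_of_isZero {E : D} (hE : IsZero E) : σ.Semistable E := by
  refine ⟨heart_of_isZero _ hE, ?_⟩
  rintro F G f g ⟨hF, -, hG, h, hT⟩ hF0
  obtain rfl : f = 0 := hE.eq_of_tgt _ _
  exact absurd (isZero_of_mono_zero σ.tstr hT hF hG) hF0

/-- The zero objects and the semistable objects of slope less than `c`. -/
def ssLT (c : EReal) : ObjectProperty D := fun Y =>
  IsZero Y ∨ (σ.Semistable Y ∧ slope cl σ.Z Y < c)

/-- The semistable objects of positive slope. -/
def ssPos : ObjectProperty D := fun Y => σ.Semistable Y ∧ 0 < slope cl σ.Z Y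

/-- The objects without non-zero maps to semistable objects of slope at most `0`. -/
def HomPos (E : D) : Prop :=
  ∀ Y, σ.Semistable Y → slope cl σ.Z Y ≤ 0 → ∀ f : E ⟶ Y, f = 0

/-- The generators of the tilted heart. -/
def tiltGen : ObjectProperty D := fun E =>
  σ.ssPos E ∨ ∃ U, σ.Semistable U ∧ slope cl σ.Z U ≤ 0 ∧ Nonempty (U⟦(1 : ℤ)⟧ ≅ E)

theorem heart_of_extClosure {S : ObjectProperty D} (h : ∀ X, S X → σ.A X) {E : D}
    (hE : ExtClosure S E) : σ.A E := by
  induction hE with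
  | of hX => exact h _ hX
  | iso e _ ih => exact σ.A.prop_of_iso e ih
  | ext hT _ _ ih₁ ih₃ => exact heart_ext σ.tstr hT ih₁ ih₃

theorem heart_of_ssLT {c : EReal} {E : D} (hE : ExtClosure (σ.ssLT c) E) : σ.A E :=
  σ.heart_of_extClosure (fun _ h => h.elim (heart_of_isZero _) (fun h => h.1.1)) hE

variable [IsTriangulated D]

/-- A non-zero map has a non-zero image `I`, and the see-saw property on both sides gives `μ(X) ≤
μ(I) ≤ μ(Y)`. -/
theorem hom_eq_zero_of_slope_lt {X Y : D} (hX : σ.Semistable X) (hY : σ.Semistable Y)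
    (h : slope cl σ.Z Y < slope cl σ.Z X) (f : X ⟶ Y) : f = 0 := by
  by_contra hf
  obtain ⟨K, I, Q, i, p, d, j, q, e, hK, hI, hQ, hpj, h1, h2⟩ :=
    exists_image σ.tstr hX.1 hY.1 f
  have hI0 : ¬ IsZero I := fun hI0 => hf (by
    rw [← hpj, hI0.eq_of_tgt p 0, zero_comp])
  have hc1 : slope cl σ.Z X ≤ slope cl σ.Z I := by
    by_cases hK0 : IsZero K
    · rw [slope_eq_slopeOf, val_triangle σ.Z h1, val_isZero σ.Z hK0, zero_add, slope_eq_slopeOf]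
    · rw [slope_eq_slopeOf, val_triangle σ.Z h1]
      exact slopeOf_add_le_right (σ.im_nonneg hK) (σ.im_nonneg hI)
        (hX.2 i p ⟨hK, hX.1, hI, d, h1⟩ hK0)
  have hc2 : slope cl σ.Z I ≤ slope cl σ.Z Y := by
    rw [slope_eq_slopeOf σ.Z Y, val_triangle σ.Z h2]
    exact slopeOf_left_le_add (σ.im_nonneg hI) (σ.im_nonneg hQ) (σ.re_nonpos hQ)
      (hY.2 j q ⟨hI, hY.1, hQ, e, h2⟩ hI0)
  exact absurd (hc1.trans hc2) (not_le.2 h)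

theorem hom_ssLT_eq_zero {X Y : D} {c : EReal} (hX : σ.Semistable X) (hc : c ≤ slope cl σ.Z X)
    (hY : ExtClosure (σ.ssLT c) Y) (f : X ⟶ Y) : f = 0 := by
  refine ExtClosure.hom_eq_zero_right ?_ hY f
  rintro V (hV | ⟨hV, hV'⟩) g
  · exact hV.eq_of_tgt _ _
  · exact σ.hom_eq_zero_of_slope_lt hX hV (hV'.trans_le hc) g

/-! ### Harder-Narasimhan filtrations and their first factor. -/

section HN

variable {σ} {n : ℕ} {X F : ℕ → D}

theorem exists_quotient_of_filtration {S : ObjectProperty D} (hS : ∀ Y, IsZero Y → S Y)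
    (hX : ∀ i < n, ∃ (f : X i ⟶ X (i + 1)) (g : X (i + 1) ⟶ F i), IsShortExact σ.A f g)
    (j : ℕ) (hF : ∀ l, j ≤ l → l < n → S (F l)) (i : ℕ) (hji : j ≤ i) (hin : i ≤ n) :
    ∃ (G : D) (f : X j ⟶ X i) (g : X i ⟶ G) (h : G ⟶ (X j)⟦(1 : ℤ)⟧),
      Triangle.mk f g h ∈ distTriang D ∧ ExtClosure S G := by
  induction i, hji using Nat.le_induction with
  | base => exact ⟨0, _, _, _, triangle_of_iso (Iso.refl _), .of (hS _ (isZero_zero D))⟩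
  | succ i hji ih =>
    obtain ⟨G, f, g, h, hT, hG⟩ := ih (by omega)
    obtain ⟨f', g', -, -, -, h', hT'⟩ := hX i (by omega)
    obtain ⟨C, p, q, a, b, c, h1, h2⟩ := exists_triangle_of_comp_left hT hT'
    exact ⟨C, _, p, q, h1, .mk_ext h2 hG (.of (hF i hji (by omega)))⟩

omit [IsTriangulated D] in
theorem slope_lt_of_lt
    (hs : ∀ i, i + 1 < n → slope cl σ.Z (F (i + 1)) < slope cl σ.Z (F i)) (j : ℕ) (i : ℕ)
    (hji : j + 1 ≤ i) (hin : i < n) : slope cl σ.Z (F i) < slope cl σ.Z (F j) := by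
  induction i, hji using Nat.le_induction with
  | base => exact hs j hin
  | succ i hji ih => exact (hs i hin).trans (ih (by omega))

/-- The first step of a Harder-Narasimhan filtration. -/
theorem exists_first_factor {E : D} (hE : σ.A E) (hE0 : ¬ IsZero E) :
    ∃ (A₁ E' : D) (f : A₁ ⟶ E) (g : E ⟶ E') (h : E' ⟶ A₁⟦(1 : ℤ)⟧),
      Triangle.mk f g h ∈ distTriang D ∧ σ.Semistable A₁ ∧ ¬ IsZero A₁ ∧
      ExtClosure (σ.ssLT (slope cl σ.Z A₁)) E' := by
  obtain ⟨n, X, F, h0, rfl, hX, hF, hs⟩ := σ.exists_HN E hE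
  have key : ∀ j, j + 1 ≤ n → IsZero (X j) → ¬ IsZero (F j) →
      ∃ (A₁ E' : D) (f : A₁ ⟶ X n) (g : X n ⟶ E') (h : E' ⟶ A₁⟦(1 : ℤ)⟧),
      Triangle.mk f g h ∈ distTriang D ∧ σ.Semistable A₁ ∧ ¬ IsZero A₁ ∧
      ExtClosure (σ.ssLT (slope cl σ.Z A₁)) E' := by
    intro j hj hXj hFj
    obtain ⟨f, g, -, -, -, h, hT⟩ := hX j hj
    have : IsIso g := (Triangle.isZero₁_iff_isIso₂ _ hT).1 hXj
    obtain ⟨G, f', g', h', hT', hG⟩ := exists_quotient_of_filtration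
      (S := σ.ssLT (slope cl σ.Z (F j))) (fun _ h => Or.inl h) hX (j + 1)
      (fun l h1 h2 => Or.inr ⟨hF l h2, slope_lt_of_lt hs j l h1 h2⟩) n hj le_rfl
    exact ⟨F j, G, _, _, _, triangle_of_iso_obj₁ hT' (asIso g).symm, hF j hj, hFj, hG⟩
  have hn : 1 ≤ n := by
    by_contra hn
    obtain rfl : n = 0 := by omega
    exact hE0 h0
  -- Zero objects are semistable of slope `⊤`, so by strict decrease only the initial factor can
  -- vanish; it is then skipped.
  by_cases hF0 : IsZero (F 0)
  · obtain ⟨f, g, -, -, -, h, hT⟩ := hX 0 hn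
    have hX1 : IsZero (X 1) := Triangle.isZero₂_of_isZero₁₃ _ hT h0 hF0
    have hn2 : 2 ≤ n := by
      by_contra hn2
      obtain rfl : n = 1 := by omega
      exact hE0 hX1
    refine key 1 hn2 hX1 fun hF1 => ?_
    have := hs 0 hn2
    rw [slope_isZero σ.Z hF1] at this
    exact absurd this not_top_lt
  · exact key 0 hn h0 hF0

/-- The last factor is a quotient of `E`, so its slope must be positive; the other factors have
larger slopes. -/
theorem extClosure_ssPos_of_homPos {E : D} (hE : σ.A E) (hE' : σ.HomPos E) :
    ExtClosure σ.ssPos E := by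
  have hz : ∀ Y, IsZero Y → σ.ssPos Y := fun Y hY =>
    ⟨σ.semistable_of_isZero hY, by rw [slope_isZero σ.Z hY]; exact EReal.zero_lt_top⟩
  obtain ⟨n, X, F, h0, rfl, hX, hF, hs⟩ := σ.exists_HN E hE
  have hpos : ∀ i < n, 0 < slope cl σ.Z (F i) := by
    intro i hi
    obtain ⟨m, rfl⟩ : ∃ m, n = m + 1 := ⟨n - 1, by omega⟩
    have hlast : 0 < slope cl σ.Z (F m) := by
      by_contra hle
      rw [not_lt] at hle
      obtain ⟨f, g, hA, -, hB, h, hT⟩ := hX m (by omega)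
      obtain rfl : g = 0 := hE' _ (hF m (by omega)) hle g
      have hzero := isZero_of_epi_zero σ.tstr hT hA hB
      rw [slope_isZero σ.Z hzero] at hle
      exact absurd hle (not_le.2 EReal.zero_lt_top)
    rcases Nat.lt_or_ge i m with him | him
    · exact hlast.trans (slope_lt_of_lt hs i m him (by omega))
    · obtain rfl : i = m := by omega
      exact hlast
  obtain ⟨G, f, g, h, hT, hG⟩ := exists_quotient_of_filtration (S := σ.ssPos) hz hX 0
    (fun l _ h2 => ⟨hF l h2, hpos l h2⟩) n (Nat.zero_le _) le_rfl
  exact .mk_ext hT (.of (hz _ h0)) hG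

end HN

variable {σ} in
theorem exists_first_factor_of_homPos {E : D} (hE : σ.A E) (hE0 : ¬ IsZero E)
    (hE' : σ.HomPos E) :
    ∃ (A₁ E' : D) (f : A₁ ⟶ E) (g : E ⟶ E') (h : E' ⟶ A₁⟦(1 : ℤ)⟧),
      Triangle.mk f g h ∈ distTriang D ∧ σ.ssPos A₁ ∧ ¬ IsZero A₁ ∧
      ExtClosure (σ.ssLT (slope cl σ.Z A₁)) E' ∧ σ.HomPos E' := by
  obtain ⟨A₁, E', f, g, h, hT, hA, hA0, hE''⟩ := exists_first_factor hE hE0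
  refine ⟨A₁, E', f, g, h, hT, ⟨hA, ?_⟩, hA0, hE'', fun Y hY hYs k => ?_⟩
  · by_contra hle
    rw [not_lt] at hle
    -- If the first slope were at most `0`, all factors would have slope at most `0`, and `E` would
    -- have no non-zero map to itself.
    have hid : 𝟙 E = 0 := by
      refine ExtClosure.hom_eq_zero_right (S := fun Y => IsZero Y ∨
        (σ.Semistable Y ∧ slope cl σ.Z Y ≤ 0)) ?_ (ExtClosure.mk_ext hT
          (.of (Or.inr ⟨hA, hle⟩)) (hE''.mono fun Y hY => .of (hY.imp id fun hY =>
            ⟨hY.1, hY.2.le.trans hle⟩))) _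
      rintro Y (hY | ⟨hY, hYs⟩) k
      · exact hY.eq_of_tgt _ _
      · exact hE' Y hY hYs k
    exact hE0 ((IsZero.iff_id_eq_zero _).2 hid)
  · obtain ⟨l, rfl⟩ := Triangle.yoneda_exact₃ _ hT k (hE' Y hY hYs _)
    rw [heart_hom_shift_eq_zero σ.tstr hA.1 hY.1 l]
    exact comp_zero

end VeryWeakPreStability

end

end VWStab

/-! ### The tilted heart. -/

namespace VWStab

namespace VeryWeakPreStability

variable {D : Type u} [Category.{v} D] [Preadditive D] [HasZeroObject D] [HasShift D ℤ]
  [∀ n : ℤ, (shiftFunctor D n).Additive] [Pretriangulated D]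
  {Γ : Type w} [AddCommGroup Γ] {cl : K0 D →+ Γ} (σ : VeryWeakPreStability cl)

theorem ssPos_of_isZero {Y : D} (hY : IsZero Y) : σ.ssPos Y :=
  ⟨σ.semistable_of_isZero hY, by rw [slope_isZero σ.Z hY]; exact EReal.zero_lt_top⟩

theorem semistable_of_iso {X Y : D} (hX : σ.Semistable X) (e : X ≅ Y) : σ.Semistable Y :=
  IsSemistable.of_iso hX e

theorem phase_slope_pos {φ : ℝ} (h1 : 1 / 2 < φ) (h2 : φ < 1) :
    0 < -(Real.cos (Real.pi * φ) / Real.sin (Real.pi * φ)) := by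
  have hπ := Real.pi_pos
  have hs : 0 < Real.sin (Real.pi * φ) := Real.sin_pos_of_pos_of_lt_pi (by positivity) (by nlinarith)
  have hc : Real.cos (Real.pi * φ) < 0 :=
    Real.cos_neg_of_pi_div_two_lt_of_lt (by nlinarith) (by nlinarith)
  have := div_neg_of_neg_of_pos hc hs
  linarith

theorem phase_slope_nonpos {φ : ℝ} (h1 : 0 < φ) (h2 : φ ≤ 1 / 2) :
    -(Real.cos (Real.pi * φ) / Real.sin (Real.pi * φ)) ≤ 0 := by
  have hπ := Real.pi_pos
  have hs : 0 < Real.sin (Real.pi * φ) := Real.sin_pos_of_pos_of_lt_pi (by positivity) (by nlinarith)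
  have hc : 0 ≤ Real.cos (Real.pi * φ) :=
    Real.cos_nonneg_of_neg_pi_div_two_le_of_le (by nlinarith) (by nlinarith)
  have := div_nonneg hc hs.le
  linarith

/-- Take `φ = 1/2 + arctan c / π`, so that `-cot (π φ) = tan (arctan c) = c`. -/
theorem exists_phase (c : ℝ) : ∃ φ : ℝ, 0 < φ ∧ φ < 1 ∧ (0 < c → 1 / 2 < φ) ∧
    (c ≤ 0 → φ ≤ 1 / 2) ∧ c = -(Real.cos (Real.pi * φ) / Real.sin (Real.pi * φ)) := by
  have hπ := Real.pi_pos
  have h1 := Real.neg_pi_div_two_lt_arctan c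
  have h2 := Real.arctan_lt_pi_div_two c
  refine ⟨(Real.pi / 2 + Real.arctan c) / Real.pi, div_pos (by linarith) hπ,
    (div_lt_one hπ).2 (by linarith), fun hc => ?_, fun hc => ?_, ?_⟩
  · rw [lt_div_iff₀ hπ]
    have := Real.arctan_pos.2 hc
    linarith
  · rw [div_le_iff₀ hπ]
    have : Real.arctan c ≤ 0 := by simpa using Real.arctan_strictMono.monotone hc
    linarith
  · rw [mul_div_cancel₀ _ hπ.ne', add_comm, Real.cos_add_pi_div_two, Real.sin_add_pi_div_two,
      neg_div, neg_neg, ← Real.tan_eq_sin_div_cos, Real.tan_arctan]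

theorem P_of_Ioc_zero_one {φ : ℝ} (h0 : 0 < φ) (h1 : φ ≤ 1) (E : D) :
    σ.P φ E ↔ σ.phaseUnit φ (E⟦(0 : ℤ)⟧) := by
  have h : ⌈φ⌉ = 1 := by rw [Int.ceil_eq_iff]; constructor <;> push_cast <;> linarith
  unfold P
  rw [h]
  simp

theorem P_of_Ioc_one_two {φ : ℝ} (h0 : 1 < φ) (h1 : φ ≤ 2) (E : D) :
    σ.P φ E ↔ σ.phaseUnit (φ - 1) (E⟦(-1 : ℤ)⟧) := by
  have h : ⌈φ⌉ = 2 := by rw [Int.ceil_eq_iff]; constructor <;> push_cast <;> linarith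
  unfold P
  rw [h]
  norm_num

theorem phaseUnit_of_iso {φ : ℝ} {X Y : D} (hX : σ.phaseUnit φ X) (e : X ≅ Y) :
    σ.phaseUnit φ Y := by
  rcases hX with hX | ⟨hX, hs⟩
  · exact Or.inl (hX.of_iso e.symm)
  · exact Or.inr ⟨σ.semistable_of_iso hX e, by rw [← slope_iso σ.Z e, hs]⟩

theorem exists_phaseUnit_pos {E : D} (hE : σ.ssPos E) :
    ∃ φ, 1 / 2 < φ ∧ φ ≤ 1 ∧ σ.phaseUnit φ E := by
  by_cases hi : (val cl σ.Z E).im = 0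
  · refine ⟨1, by norm_num, le_rfl, Or.inr ⟨hE.1, ?_⟩⟩
    rw [if_pos rfl, slope_eq_slopeOf, slopeOf_of_im_eq_zero hi]
  · have hs : slope cl σ.Z E = _ := slopeOf_of_im_ne_zero hi
    have hpos := hE.2
    rw [hs, EReal.coe_pos] at hpos
    obtain ⟨φ, -, h1, h2, -, h3⟩ := exists_phase (-(val cl σ.Z E).re / (val cl σ.Z E).im)
    exact ⟨φ, h2 hpos, h1.le, Or.inr ⟨hE.1, by rw [if_neg h1.ne, hs, h3]⟩⟩

theorem exists_phaseUnit_nonpos {E : D} (hE : σ.Semistable E) (hE' : slope cl σ.Z E ≤ 0) :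
    ∃ φ, 0 < φ ∧ φ ≤ 1 / 2 ∧ σ.phaseUnit φ E := by
  by_cases hi : (val cl σ.Z E).im = 0
  · rw [slope_eq_slopeOf, slopeOf_of_im_eq_zero hi] at hE'
    exact absurd hE' (not_le.2 EReal.zero_lt_top)
  · have hs : slope cl σ.Z E = _ := slopeOf_of_im_ne_zero hi
    rw [hs, EReal.coe_nonpos] at hE'
    obtain ⟨φ, h0, h1, -, h2, h3⟩ := exists_phase (-(val cl σ.Z E).re / (val cl σ.Z E).im)
    exact ⟨φ, h0, h2 hE', Or.inr ⟨hE, by rw [if_neg h1.ne, hs, h3]⟩⟩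

/-- Phases in `(1/2, 1]` are the positive slopes, and phases in `(1, 3/2]` are the shifts of slopes
at most `0`. From here on the trigonometric description is no longer needed. -/
theorem ADag_iff (E : D) : σ.ADag E ↔ ExtClosure σ.tiltGen E := by
  constructor
  · refine ExtClosure.mono ?_
    rintro X ⟨φ, ⟨h1, h2⟩, hX⟩
    rcases le_or_gt φ 1 with h | h
    · rw [σ.P_of_Ioc_zero_one (by linarith) h] at hX
      refine .iso ((shiftFunctorZero D ℤ).app X) (.of (Or.inl ?_))
      rcases hX with hX | ⟨hX, hs⟩
      · exact σ.ssPos_of_isZero hX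
      · refine ⟨hX, ?_⟩
        rw [hs]
        split_ifs with h'
        · exact EReal.zero_lt_top
        · exact EReal.coe_pos.2 (phase_slope_pos h1 (lt_of_le_of_ne h h'))
    · rw [σ.P_of_Ioc_one_two h (by linarith)] at hX
      have e : X⟦(-1 : ℤ)⟧⟦(1 : ℤ)⟧ ≅ X := shiftNegShift X 1
      rcases hX with hX | ⟨hX, hs⟩
      · refine .of (Or.inl (σ.ssPos_of_isZero ?_))
        exact ((shiftFunctor D (1 : ℤ)).map_isZero hX).of_iso e.symm
      · refine .of (Or.inr ⟨_, hX, ?_, ⟨e⟩⟩)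
        rw [hs, if_neg (by linarith), EReal.coe_nonpos]
        exact phase_slope_nonpos (by linarith) (by linarith)
  · refine ExtClosure.mono ?_
    rintro X (hX | ⟨U, hU, hs, ⟨e⟩⟩)
    · obtain ⟨φ, h1, h2, hφ⟩ := σ.exists_phaseUnit_pos hX
      refine .of ⟨φ, ⟨h1, by linarith⟩, (σ.P_of_Ioc_zero_one (by linarith) h2 X).2 ?_⟩
      exact σ.phaseUnit_of_iso hφ ((shiftFunctorZero D ℤ).app X).symm
    · obtain ⟨φ, h1, h2, hφ⟩ := σ.exists_phaseUnit_nonpos hU hs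
      refine .of ⟨φ + 1, ⟨by linarith, by linarith⟩,
        (σ.P_of_Ioc_one_two (by linarith) (by linarith) X).2 ?_⟩
      rw [add_sub_cancel_right]
      exact σ.phaseUnit_of_iso hφ
        ((shiftShiftNeg U (1 : ℤ)).symm ≪≫ (shiftFunctor D (-1 : ℤ)).mapIso e)

theorem ADag_ext {X Y W : D} {f : X ⟶ Y} {g : Y ⟶ W} {h : W ⟶ X⟦(1 : ℤ)⟧}
    (hT : Triangle.mk f g h ∈ distTriang D) (hX : σ.ADag X) (hW : σ.ADag W) : σ.ADag Y :=
  ExtClosure.mk_ext hT hX hW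

theorem ADag_of_ssPos {X : D} (hX : ExtClosure σ.ssPos X) : σ.ADag X :=
  (σ.ADag_iff X).2 (hX.mono fun _ h => .of (Or.inl h))

theorem ADag_shift_of_ssLT {c : EReal} (hc : c ≤ 0) {X : D} (hX : ExtClosure (σ.ssLT c) X) :
    σ.ADag (X⟦(1 : ℤ)⟧) := by
  refine (σ.ADag_iff _).2 (hX.shift.mono ?_)
  rintro Y ⟨U, hU | ⟨hU, hs⟩, ⟨e⟩⟩
  · exact .of (Or.inl (σ.ssPos_of_isZero
      (((shiftFunctor D (1 : ℤ)).map_isZero hU).of_iso e.symm)))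
  · exact .of (Or.inr ⟨U, hU, hs.le.trans hc, ⟨e⟩⟩)

theorem ADag_amplitude {E : D} (hE : σ.ADag E) :
    σ.tstr.IsLE E 0 ∧ σ.tstr.IsGE E (-1) := by
  rw [ADag_iff] at hE
  induction hE with
  | of hX =>
    rcases hX with hX | ⟨U, hU, -, ⟨e⟩⟩
    · obtain ⟨_, _⟩ := (σ.tstr.mem_heart_iff _).1 hX.1.1
      exact ⟨inferInstance, σ.tstr.isGE_of_ge _ (-1) 0⟩
    · obtain ⟨_, _⟩ := (σ.tstr.mem_heart_iff _).1 hU.1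
      have := σ.tstr.isLE_shift U 0 1 (-1)
      have := σ.tstr.isGE_shift U 0 1 (-1)
      have := σ.tstr.isLE_of_le (U⟦(1 : ℤ)⟧) (-1) 0
      exact ⟨σ.tstr.isLE_of_iso e 0, σ.tstr.isGE_of_iso e (-1)⟩
  | iso e _ ih =>
    obtain ⟨_, _⟩ := ih
    exact ⟨σ.tstr.isLE_of_iso e 0, σ.tstr.isGE_of_iso e (-1)⟩
  | ext hT _ _ ih₁ ih₃ =>
    exact ⟨σ.tstr.isLE₂ _ hT 0 ih₁.1 ih₃.1, σ.tstr.isGE₂ _ hT (-1) ih₁.2 ih₃.2⟩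

/-- The cohomology triangle `H⁻¹(E)[1] ⟶ E ⟶ H⁰(E)` of an object of the tilted heart. -/
theorem exists_cohomology_triangle {E : D} (hE : σ.ADag E) :
    ∃ (F T : D) (f : F⟦(1 : ℤ)⟧ ⟶ E) (g : E ⟶ T) (h : T ⟶ F⟦(1 : ℤ)⟧⟦(1 : ℤ)⟧),
      Triangle.mk f g h ∈ distTriang D ∧ σ.A F ∧ σ.A T := by
  obtain ⟨hle, hge⟩ := σ.ADag_amplitude hE
  obtain ⟨K, T, hK, hT, a, b, c, hd⟩ := σ.tstr.exists_triangle E (-1) 0 (by lia)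
  have hK' : σ.tstr.IsLE K (-1) := ⟨hK⟩
  have hT' : σ.tstr.IsGE T 0 := ⟨hT⟩
  have hK1 : σ.tstr.IsLE (K⟦(1 : ℤ)⟧) (-2) := σ.tstr.isLE_shift K (-1) 1 (-2)
  have hT1 : σ.tstr.IsGE (T⟦(-1 : ℤ)⟧) 1 := σ.tstr.isGE_shift T 0 (-1) 1
  have hTle : σ.tstr.IsLE T 0 := σ.tstr.isLE₂ _ (rot_of_distTriang _ hd) 0 hle
    (σ.tstr.isLE_of_le (K⟦(1 : ℤ)⟧) (-2) 0)
  have hKge : σ.tstr.IsGE K (-1) := σ.tstr.isGE₂ _ (inv_rot_of_distTriang _ hd) (-1)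
    (σ.tstr.isGE_of_ge (T⟦(-1 : ℤ)⟧) (-1) 1) hge
  exact ⟨K⟦(-1 : ℤ)⟧, T, _, _, _, triangle_of_iso_obj₁ hd (shiftNegShift K 1),
    (σ.tstr.mem_heart_iff _).2 ⟨σ.tstr.isLE_shift K (-1) (-1) 0, σ.tstr.isGE_shift K (-1) (-1) 0⟩,
    (σ.tstr.mem_heart_iff _).2 ⟨hTle, hT'⟩⟩

variable [IsTriangulated D]

theorem homPos_of_ADag {E : D} (hE : σ.ADag E) : σ.HomPos E := by
  intro Y hY hs f
  refine ExtClosure.hom_eq_zero_left ?_ ((σ.ADag_iff E).1 hE) f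
  rintro X (hX | ⟨U, hU, -, ⟨e⟩⟩) g
  · exact σ.hom_eq_zero_of_slope_lt hX.1 hY (hs.trans_lt hX.2) g
  · rw [← cancel_epi e.hom, comp_zero]
    exact heart_hom_shift_eq_zero σ.tstr hU.1 hY.1 _

theorem hom_shift_ADag_eq_zero {U E : D} (hU : σ.ssPos U) (hE : σ.ADag E)
    (f : U⟦(1 : ℤ)⟧ ⟶ E) : f = 0 := by
  refine ExtClosure.hom_eq_zero_right ?_ ((σ.ADag_iff E).1 hE) f
  rintro X (hX | ⟨V, hV, hs, ⟨e⟩⟩) g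
  · exact heart_hom_shift_eq_zero σ.tstr hU.1.1 hX.1.1 _
  · rw [← cancel_mono e.inv, zero_comp]
    obtain ⟨k, hk⟩ := (shiftFunctor D (1 : ℤ)).map_surjective (g ≫ e.inv)
    rw [← hk, σ.hom_eq_zero_of_slope_lt hU.1 hV (hs.trans_lt hU.2) k, Functor.map_zero]

/-- An object of the tilted heart that does not lie in `A` starts with `U[1]`, where `U` is the
first factor of its cohomology in degree `-1`. -/
theorem exists_first_factor_of_ADag {E : D} (hE : σ.ADag E) (hEA : ¬ σ.A E) :
    ∃ (U F T E' : D) (f : U⟦(1 : ℤ)⟧ ⟶ E) (g : E ⟶ E') (h : E' ⟶ U⟦(1 : ℤ)⟧⟦(1 : ℤ)⟧)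
      (a : F⟦(1 : ℤ)⟧ ⟶ E') (b : E' ⟶ T) (c : T ⟶ F⟦(1 : ℤ)⟧⟦(1 : ℤ)⟧),
      Triangle.mk f g h ∈ distTriang D ∧ Triangle.mk a b c ∈ distTriang D ∧
      σ.Semistable U ∧ slope cl σ.Z U ≤ 0 ∧ ExtClosure (σ.ssLT (slope cl σ.Z U)) F ∧
      ExtClosure σ.ssPos T := by
  obtain ⟨H, T, f, g, h, hd, hH, hT⟩ := σ.exists_cohomology_triangle hE
  have hH0 : ¬ IsZero H := fun hH0 => hEA (by
    have : IsIso g := (Triangle.isZero₁_iff_isIso₂ _ hd).1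
      ((shiftFunctor D (1 : ℤ)).map_isZero hH0)
    exact σ.A.prop_of_iso (asIso g).symm hT)
  obtain ⟨U, F, u, v, w, hd', hU, hU0, hF⟩ := exists_first_factor hH hH0
  -- If the slope were positive, `U[1] ⟶ E` would vanish, so `U[1] ⟶ H[1]` would factor through
  -- `T[-1]`. For degree reasons it would be zero, contradicting `U ≠ 0`.
  have hUs : slope cl σ.Z U ≤ 0 := by
    by_contra hs
    rw [not_le] at hs
    have h1 : u⟦(1 : ℤ)⟧' ≫ f = 0 := σ.hom_shift_ADag_eq_zero ⟨hU, hs⟩ hE _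
    obtain ⟨k, hk⟩ := Triangle.coyoneda_exact₂ _ (inv_rot_of_distTriang _ hd) (u⟦(1 : ℤ)⟧') h1
    obtain ⟨_, _⟩ := (σ.tstr.mem_heart_iff U).1 hU.1
    obtain ⟨_, _⟩ := (σ.tstr.mem_heart_iff T).1 hT
    have hU1 : σ.tstr.IsLE (U⟦(1 : ℤ)⟧) (-1) := σ.tstr.isLE_shift U 0 1 (-1)
    have hT1 : σ.tstr.IsGE (T⟦(-1 : ℤ)⟧) 1 := σ.tstr.isGE_shift T 0 (-1) 1
    have hk0 : k = 0 := σ.tstr.zero_of_isLE_of_isGE k (-1) 1 (by lia) hU1 hT1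
    have hu : u⟦(1 : ℤ)⟧' = 0 := by rw [hk, hk0]; exact zero_comp
    obtain rfl : u = 0 := (shiftFunctor D (1 : ℤ)).map_injective (by
      rw [hu, Functor.map_zero])
    exact hU0 (isZero_of_mono_zero σ.tstr hd' hU.1 (σ.heart_of_ssLT hF))
  have hTpos : σ.HomPos T := by
    intro Y hY hs k
    obtain ⟨l, rfl⟩ := Triangle.yoneda_exact₃ _ hd k (σ.homPos_of_ADag hE Y hY hs _)
    obtain ⟨_, _⟩ := (σ.tstr.mem_heart_iff H).1 hH
    obtain ⟨_, _⟩ := (σ.tstr.mem_heart_iff Y).1 hY.1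
    have hH1 : σ.tstr.IsLE (H⟦(1 : ℤ)⟧) (-1) := σ.tstr.isLE_shift H 0 1 (-1)
    have hH2 : σ.tstr.IsLE (H⟦(1 : ℤ)⟧⟦(1 : ℤ)⟧) (-2) := σ.tstr.isLE_shift _ (-1) 1 (-2)
    rw [σ.tstr.zero_of_isLE_of_isGE l (-2) 0 (by lia) hH2 ‹_›]
    exact comp_zero
  -- The octahedron for `U[1] ⟶ H[1] ⟶ E` exhibits the quotient `E'` as an extension of `T` by
  -- `F[1]`.
  obtain ⟨E', p, q, a, b, c, h1, h2⟩ := exists_triangle_of_comp_left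
    (Triangle.shift_distinguished _ hd' 1) hd
  exact ⟨U, F, T, E', _, _, _, a, b, c, h1, h2, hU, hUs, hF,
    extClosure_ssPos_of_homPos hT hTpos⟩

end VeryWeakPreStability

end VWStab

/-! ### Numerical properties of classes, and semistability as the parameter tends to `0`. -/

namespace VWStab

/-- Since `v - c w` lies in the kernel, `q v - c · polar q v w + c² q w ≤ 0`; hence the polar term
is non-negative. -/
theorem quadraticForm_add_nonneg {V : Type*} [AddCommGroup V] [Module ℝ V]
    (q : QuadraticForm ℝ V) (L : V →ₗ[ℝ] ℂ) (hq : ∀ x, L x = 0 → x ≠ 0 → q x < 0) {v w : V}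
    (c : ℝ) (hc : 0 < c) (h : L v = c • L w) (hv : 0 ≤ q v) (hw : 0 ≤ q w) : 0 ≤ q (v + w) := by
  have h1 : q (v + (-c) • w) ≤ 0 := by
    by_cases h0 : v + (-c) • w = 0
    · rw [h0, map_zero]
    · exact (hq _ (by rw [map_add, map_smul, h, neg_smul, add_neg_cancel]) h0).le
  rw [QuadraticMap.map_add q, QuadraticMap.map_smul, QuadraticMap.polar_smul_right] at h1
  rw [QuadraticMap.map_add q]
  simp only [smul_eq_mul] at h1
  have h2 : 0 ≤ c * QuadraticMap.polar q v w := by nlinarith [mul_nonneg (mul_self_nonneg c) hw]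
  have h3 := nonneg_of_mul_nonneg_right h2 hc
  positivity

/-- A non-zero vector with `q ≥ 0` is not in the kernel, so both values lie on the open negative
imaginary axis and are positive multiples of each other. -/
theorem quadraticForm_add_nonneg_of_im_nonpos {V : Type*} [AddCommGroup V] [Module ℝ V]
    (q : QuadraticForm ℝ V) (L : V →ₗ[ℝ] ℂ) (hq : ∀ x, L x = 0 → x ≠ 0 → q x < 0) {v w : V}
    (hv0 : (L v).re = 0) (hw0 : (L w).re = 0) (hv1 : (L v).im ≤ 0) (hw1 : (L w).im ≤ 0)
    (hv : 0 ≤ q v) (hw : 0 ≤ q w) : 0 ≤ q (v + w) := by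
  rcases eq_or_ne v 0 with rfl | hv'
  · rwa [zero_add]
  rcases eq_or_ne w 0 with rfl | hw'
  · rwa [add_zero]
  have h1 : (L v).im < 0 := lt_of_le_of_ne hv1 fun h =>
    absurd (hq v (Complex.ext hv0 h) hv') (not_lt.2 hv)
  have h2 : (L w).im < 0 := lt_of_le_of_ne hw1 fun h =>
    absurd (hq w (Complex.ext hw0 h) hw') (not_lt.2 hw)
  refine quadraticForm_add_nonneg q L hq ((L v).im / (L w).im) (div_pos_of_neg_of_neg h1 h2)
    (Complex.ext ?_ ?_) hv hw
  · simp [hv0, hw0]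
  · simp [h2.ne]

section

variable {D : Type u} [Category.{v} D] [Preadditive D] [HasZeroObject D] [HasShift D ℤ]
  [∀ n : ℤ, (shiftFunctor D n).Additive] [Pretriangulated D]
  {Γ : Type w} [AddCommGroup Γ]

/-- The class in `Γ` of an object. -/
def cls (cl : K0 D →+ Γ) (E : D) : Γ := cl (K0.of E)

variable {cl : K0 D →+ Γ}

theorem cls_triangle {X Y V : D} {f : X ⟶ Y} {g : Y ⟶ V} {h : V ⟶ X⟦(1 : ℤ)⟧}
    (hT : Triangle.mk f g h ∈ distTriang D) : cls cl Y = cls cl X + cls cl V := by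
  simp [cls, K0.of_triangle hT]

theorem cls_isZero {X : D} (hX : IsZero X) : cls cl X = 0 := by simp [cls, K0.of_isZero hX]

theorem cls_iso {X Y : D} (e : X ≅ Y) : cls cl X = cls cl Y := by simp [cls, K0.of_iso e]

theorem cls_shift (X : D) : cls cl (X⟦(1 : ℤ)⟧) = - cls cl X := by simp [cls, K0.of_shift]

namespace VeryWeakPreStability

variable (σ : VeryWeakPreStability cl)

/-- The function `- Re Z`, the imaginary part of `Z†_t`. -/
def rk : Γ →+ ℝ := -(Complex.reAddGroupHom.comp σ.Z.toAddMonoidHom)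

/-- The function `Im Z`. -/
def im : Γ →+ ℝ := Complex.imAddGroupHom.comp σ.Z.toAddMonoidHom

theorem rk_apply (x : Γ) : σ.rk x = -(σ.Z x).re := rfl

theorem im_apply (x : Γ) : σ.im x = (σ.Z x).im := rfl

theorem slope_lt_top_iff {E : D} : slope cl σ.Z E < ⊤ ↔ σ.im (cls cl E) ≠ 0 := by
  rw [lt_top_iff_ne_top, ne_eq, slope_eq_slopeOf, slopeOf_eq_top_iff]
  rfl

theorem slope_eq_coe {E : D} (h : σ.im (cls cl E) ≠ 0) :
    slope cl σ.Z E = ((σ.rk (cls cl E) / σ.im (cls cl E) : ℝ) : EReal) :=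
  slopeOf_of_im_ne_zero h

theorem im_cls_nonneg {E : D} (hE : σ.A E) : 0 ≤ σ.im (cls cl E) := σ.im_nonneg hE

theorem rk_cls_nonneg {E : D} (hE : σ.A E) (h : σ.im (cls cl E) = 0) : 0 ≤ σ.rk (cls cl E) := by
  rw [rk_apply]
  have : (σ.Z (cls cl E)).re ≤ 0 := σ.re_nonpos hE h
  linarith

theorem C_of_rk_im {E : D} (hE : σ.A E) (h1 : σ.rk (cls cl E) = 0) (h2 : σ.im (cls cl E) = 0) :
    σ.C E := by
  rw [rk_apply, neg_eq_zero] at h1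
  exact ⟨hE, Complex.ext h1 h2⟩

theorem cls_mem_Γ₀ {E : D} (hE : σ.C E) : cls cl E ∈ σ.Γ₀ :=
  ⟨1, one_ne_zero, by rw [one_smul]; exact Submodule.subset_span ⟨E, hE, rfl⟩⟩

theorem rk_im_of_ssPos {E : D} (hE : σ.ssPos E) :
    0 ≤ σ.rk (cls cl E) ∧ (σ.rk (cls cl E) = 0 → σ.im (cls cl E) = 0) := by
  by_cases h : σ.im (cls cl E) = 0
  · exact ⟨σ.rk_cls_nonneg hE.1.1 h, fun _ => h⟩
  · have h1 : 0 < σ.im (cls cl E) := lt_of_le_of_ne (σ.im_cls_nonneg hE.1.1) (Ne.symm h)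
    have h2 := hE.2
    rw [σ.slope_eq_coe h, EReal.coe_pos, div_pos_iff_of_pos_right h1] at h2
    exact ⟨h2.le, fun h' => absurd h' h2.ne'⟩

theorem rk_im_of_slope_nonpos {U : D} (hU : σ.Semistable U) (hs : slope cl σ.Z U ≤ 0) :
    σ.rk (cls cl U) ≤ 0 ∧ 0 < σ.im (cls cl U) := by
  have h : σ.im (cls cl U) ≠ 0 := σ.slope_lt_top_iff.1 (hs.trans_lt EReal.zero_lt_top)
  have h1 : 0 < σ.im (cls cl U) := lt_of_le_of_ne (σ.im_cls_nonneg hU.1) (Ne.symm h)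
  rw [σ.slope_eq_coe h, EReal.coe_nonpos, div_le_iff₀ h1, zero_mul] at hs
  exact ⟨hs, h1⟩

/-- Each non-zero generator lies strictly below the line `rk = c · im`. The equality clause is what
later turns a slope inequality into the vanishing of a whole class. -/
theorem cls_of_ssLT_coe {c : ℝ} {E : D} (hE : ExtClosure (σ.ssLT c) E) :
    0 ≤ σ.im (cls cl E) ∧ σ.rk (cls cl E) ≤ c * σ.im (cls cl E) ∧
      (σ.rk (cls cl E) = c * σ.im (cls cl E) → cls cl E = 0) := by
  induction hE with
  | @of X hX =>
    rcases hX with hX | ⟨hX, hs⟩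
    · simp [cls_isZero hX]
    · have h : σ.im (cls cl X) ≠ 0 := σ.slope_lt_top_iff.1 (hs.trans (EReal.coe_lt_top c))
      have h1 : 0 < σ.im (cls cl X) := lt_of_le_of_ne (σ.im_cls_nonneg hX.1) (Ne.symm h)
      rw [σ.slope_eq_coe h, EReal.coe_lt_coe_iff, div_lt_iff₀ h1] at hs
      exact ⟨h1.le, hs.le, fun h' => absurd h' hs.ne⟩
  | iso e _ ih => rwa [← cls_iso e]
  | @ext T hT _ _ ih₁ ih₃ =>
    have h : cls cl T.obj₂ = cls cl T.obj₁ + cls cl T.obj₃ := cls_triangle hT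
    obtain ⟨h1, h2, h3⟩ := ih₁
    obtain ⟨h4, h5, h6⟩ := ih₃
    rw [h, map_add, map_add]
    refine ⟨by linarith, by linarith, fun h' => ?_⟩
    rw [h3 (by linarith), h6 (by linarith), add_zero]

theorem cls_of_ssLT_top {E : D} (hE : ExtClosure (σ.ssLT ⊤) E) :
    0 ≤ σ.im (cls cl E) ∧ (σ.im (cls cl E) = 0 → cls cl E = 0) := by
  induction hE with
  | @of X hX =>
    rcases hX with hX | ⟨hX, hs⟩
    · simp [cls_isZero hX]
    · exact ⟨σ.im_cls_nonneg hX.1, fun h => absurd h (σ.slope_lt_top_iff.1 hs)⟩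
  | iso e _ ih => rwa [← cls_iso e]
  | @ext T hT _ _ ih₁ ih₃ =>
    have h : cls cl T.obj₂ = cls cl T.obj₁ + cls cl T.obj₃ := cls_triangle hT
    obtain ⟨h1, h3⟩ := ih₁
    obtain ⟨h4, h6⟩ := ih₃
    rw [h, map_add]
    refine ⟨by linarith, fun h' => ?_⟩
    rw [h3 (by linarith), h6 (by linarith), add_zero]

/-- The value of a quadratic form on `(Γ/Γ₀) ⊗ ℝ` at an element of `Γ`. -/
def qVal (Q : QuadraticForm ℝ (ℝ ⊗[ℤ] (Γ ⧸ σ.Γ₀))) (x : Γ) : ℝ := Q (1 ⊗ₜ[ℤ] σ.Γ₀.mkQ x)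

variable {σ} {Q : QuadraticForm ℝ (ℝ ⊗[ℤ] (Γ ⧸ σ.Γ₀))}

theorem qVal_neg (x : Γ) : σ.qVal Q (-x) = σ.qVal Q x := by
  simp only [qVal, map_neg, TensorProduct.tmul_neg, QuadraticMap.map_neg]

theorem qVal_add_of_mem (x : Γ) {y : Γ} (hy : y ∈ σ.Γ₀) : σ.qVal Q (x + y) = σ.qVal Q x := by
  have : σ.Γ₀.mkQ y = 0 := by simpa using hy
  simp only [qVal, map_add, this, add_zero]

theorem Zbar_tmul (x : Γ) : σ.Zbar (1 ⊗ₜ[ℤ] σ.Γ₀.mkQ x) = σ.Z x := by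
  simp [Zbar]

theorem qVal_add_nonneg (hQ : σ.IsSupportForm Q) {x y : Γ} (hx : σ.rk x = 0) (hy : σ.rk y = 0)
    (hx' : σ.im x ≤ 0) (hy' : σ.im y ≤ 0) (hqx : 0 ≤ σ.qVal Q x) (hqy : 0 ≤ σ.qVal Q y) :
    0 ≤ σ.qVal Q (x + y) := by
  rw [rk_apply, neg_eq_zero] at hx hy
  unfold qVal
  rw [map_add, TensorProduct.tmul_add]
  refine quadraticForm_add_nonneg_of_im_nonpos Q σ.Zbar hQ.neg_def ?_ ?_ ?_ ?_ hqx hqy <;>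
    rw [Zbar_tmul] <;> assumption

namespace BGInequality

variable (B : σ.BGInequality)

/-- The function `ΔI` with real values. -/
noncomputable def dI : Γ →+ ℝ := (Rat.castHom ℝ).toAddMonoidHom.comp B.ΔI.toAddMonoidHom

/-- The function `ΔR` with real values. -/
noncomputable def dR : Γ →+ ℝ := (Rat.castHom ℝ).toAddMonoidHom.comp B.ΔR.toAddMonoidHom

/-- The real part of `Z†_t`. -/
noncomputable def reDag (t : ℝ) (x : Γ) : ℝ := σ.im x + t * B.dI x

theorem reDag_add (t : ℝ) (x y : Γ) : B.reDag t (x + y) = B.reDag t x + B.reDag t y := by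
  simp only [reDag, map_add]; ring

theorem ZDag_im (t : ℝ) (x : Γ) : (B.ZDag t x).im = σ.rk x := by
  simp [ZDag_apply, rk_apply]

theorem ZDag_re (t : ℝ) (x : Γ) : (B.ZDag t x).re = B.reDag t x := by
  rw [ZDag_apply, reDag, im_apply, Complex.add_re, Complex.re_ofReal_mul]
  simp only [Complex.mul_re, Complex.neg_re, Complex.I_re, Complex.neg_im, Complex.I_im,
    Complex.ratCast_re]
  rw [neg_zero, zero_mul, zero_sub, neg_mul, one_mul, neg_neg]
  rfl

theorem Δ_eq (x : Γ) : B.Δ x = - σ.rk x * B.dR x + σ.im x * B.dI x := by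
  rw [rk_apply, neg_neg]; rfl

theorem Δ_nonneg_of_semistable {E : D} (hE : σ.Semistable E) : 0 ≤ B.Δ (cls cl E) :=
  B.nonneg E hE

theorem dI_nonpos {E : D} (hE : σ.C E) : B.dI (cls cl E) ≤ 0 :=
  Rat.cast_nonpos.2 (B.ΔI_C E hE)

theorem dR_eq_zero {E : D} (hE : σ.C E) : B.dR (cls cl E) = 0 :=
  Rat.cast_eq_zero.2 (B.ΔR_C E hE)

/-- Numerical properties of the objects of the torsion part of the tilt. -/
theorem cls_of_ssPos {E : D} (hE : ExtClosure σ.ssPos E) :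
    0 ≤ σ.im (cls cl E) ∧ 0 ≤ σ.rk (cls cl E) ∧ (σ.rk (cls cl E) = 0 →
      cls cl E ∈ σ.Γ₀ ∧ σ.im (cls cl E) = 0 ∧ B.dI (cls cl E) ≤ 0 ∧ B.dR (cls cl E) = 0) := by
  induction hE with
  | @of X hX =>
    obtain ⟨h1, h2⟩ := σ.rk_im_of_ssPos hX
    refine ⟨σ.im_cls_nonneg hX.1.1, h1, fun h => ?_⟩
    have hC := σ.C_of_rk_im hX.1.1 h (h2 h)
    exact ⟨σ.cls_mem_Γ₀ hC, h2 h, B.dI_nonpos hC, B.dR_eq_zero hC⟩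
  | iso e _ ih => rwa [← cls_iso e]
  | @ext T hT _ _ ih₁ ih₃ =>
    have h : cls cl T.obj₂ = cls cl T.obj₁ + cls cl T.obj₃ := cls_triangle hT
    obtain ⟨h1, h2, h3⟩ := ih₁
    obtain ⟨h4, h5, h6⟩ := ih₃
    rw [h]
    simp only [map_add]
    refine ⟨by linarith, by linarith, fun h' => ?_⟩
    obtain ⟨a1, a2, a3, a4⟩ := h3 (by linarith)
    obtain ⟨b1, b2, b3, b4⟩ := h6 (by linarith)
    exact ⟨add_mem a1 b1, by linarith, by linarith, by linarith⟩

/-- Numerical properties of the objects of the tilted heart. -/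
theorem cls_of_ADag (hQ : σ.IsSupportForm Q) {E : D} (hE : σ.ADag E) :
    0 ≤ σ.rk (cls cl E) ∧ (σ.rk (cls cl E) = 0 →
      σ.im (cls cl E) ≤ 0 ∧ B.dI (cls cl E) ≤ 0 ∧ 0 ≤ σ.qVal Q (cls cl E)) := by
  rw [ADag_iff] at hE
  induction hE with
  | @of X hX =>
    rcases hX with hX | ⟨U, hU, hs, ⟨e⟩⟩
    · obtain ⟨h1, h2⟩ := σ.rk_im_of_ssPos hX
      refine ⟨h1, fun h => ⟨(h2 h).le, ?_, hQ.nonneg _ hX.1⟩⟩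
      exact B.dI_nonpos (σ.C_of_rk_im hX.1.1 h (h2 h))
    · obtain ⟨h1, h2⟩ := σ.rk_im_of_slope_nonpos hU hs
      rw [← cls_iso e, cls_shift, qVal_neg]
      simp only [map_neg]
      refine ⟨by linarith, fun h => ⟨by linarith, ?_, hQ.nonneg _ hU⟩⟩
      -- In rank 0 the BG inequality reads `im U · dI U ≥ 0` with `im U > 0`; the shift reverses the
      -- sign of `dI`.
      have h3 := B.Δ_nonneg_of_semistable hU
      rw [Δ_eq, h, zero_mul, zero_add] at h3
      have := nonneg_of_mul_nonneg_right h3 h2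
      linarith
  | iso e _ ih => rwa [← cls_iso e]
  | @ext T hT _ _ ih₁ ih₃ =>
    have h : cls cl T.obj₂ = cls cl T.obj₁ + cls cl T.obj₃ := cls_triangle hT
    obtain ⟨h1, h2⟩ := ih₁
    obtain ⟨h3, h4⟩ := ih₃
    rw [h]
    simp only [map_add]
    refine ⟨by linarith, fun h' => ?_⟩
    obtain ⟨a1, a2, a3⟩ := h2 (by linarith)
    obtain ⟨b1, b2, b3⟩ := h4 (by linarith)
    exact ⟨by linarith, by linarith,
      qVal_add_nonneg hQ (by linarith) (by linarith) a1 b1 a3 b3⟩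

/-- Semistability for `Z†_t` up to objects whose `Z†_t` vanishes. -/
def WeakSemistable (t : ℝ) (E : D) : Prop :=
  σ.ADag E ∧ ∀ ⦃F G : D⦄ (f : F ⟶ E) (g : E ⟶ G), IsShortExact σ.ADag f g →
    σ.rk (cls cl F) * B.reDag t (cls cl E) ≤ σ.rk (cls cl E) * B.reDag t (cls cl F)

theorem reDag_nonpos (hQ : σ.IsSupportForm Q) {t : ℝ} (ht : 0 < t) {E : D} (hE : σ.ADag E)
    (h : σ.rk (cls cl E) = 0) : B.reDag t (cls cl E) ≤ 0 := by
  obtain ⟨h1, h2, -⟩ := (B.cls_of_ADag hQ hE).2 h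
  have := mul_nonpos_of_nonneg_of_nonpos ht.le h2
  unfold reDag
  linarith

theorem im_dI_eq_zero (hQ : σ.IsSupportForm Q) {t : ℝ} (ht : 0 < t) {E : D} (hE : σ.ADag E)
    (h : σ.rk (cls cl E) = 0) (h' : 0 ≤ B.reDag t (cls cl E)) :
    σ.im (cls cl E) = 0 ∧ B.dI (cls cl E) = 0 := by
  obtain ⟨h1, h2, -⟩ := (B.cls_of_ADag hQ hE).2 h
  have h3 := mul_nonpos_of_nonneg_of_nonpos ht.le h2
  unfold reDag at h'
  have h4 : t * B.dI (cls cl E) = 0 := by linarith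
  exact ⟨by linarith, (mul_eq_zero.1 h4).resolve_left ht.ne'⟩

/-- The weak notion is cross-multiplied: it is closed in `t` and passes to subobjects and quotients
of equal phase. A rank-zero quotient has slope `⊤` and gives no information, but there
`reDag_nonpos` supplies the inequality. -/
theorem weakSemistable_of_dagSemistable (hQ : σ.IsSupportForm Q) {t : ℝ} (ht : 0 < t) {E : D}
    (hE : B.DagSemistable t E) : B.WeakSemistable t E := by
  refine ⟨hE.1, fun F G f g hfg => ?_⟩
  have hfg' := hfg
  obtain ⟨hF, -, hG, h, hT⟩ := hfg
  have hc : cls cl E = cls cl F + cls cl G := cls_triangle hT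
  have hF0 := (B.cls_of_ADag hQ hF).1
  have hG0 := (B.cls_of_ADag hQ hG).1
  by_cases hz : IsZero F
  · simp [cls_isZero hz, reDag]
  have hs := hE.2 f g hfg' hz
  rw [slope_eq_slopeOf, slope_eq_slopeOf] at hs
  have e1 : (val cl (B.ZDag t) F).im = σ.rk (cls cl F) := B.ZDag_im t _
  have e2 : (val cl (B.ZDag t) G).im = σ.rk (cls cl G) := B.ZDag_im t _
  have e3 : (val cl (B.ZDag t) F).re = B.reDag t (cls cl F) := B.ZDag_re t _
  have e4 : (val cl (B.ZDag t) G).re = B.reDag t (cls cl G) := B.ZDag_re t _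
  rw [hc, map_add, reDag_add]
  rcases hG0.eq_or_lt with hG1 | hG1
  · have := B.reDag_nonpos hQ ht hG hG1.symm
    rw [← hG1]
    nlinarith
  rcases hF0.eq_or_lt with hF1 | hF1
  · rw [slopeOf_of_im_eq_zero (by rw [e1, hF1]), top_le_iff, slopeOf_eq_top_iff, e2] at hs
    exact absurd hs hG1.ne'
  rw [slopeOf_le_slopeOf_iff (by rwa [e1]) (by rwa [e2]), e1, e2, e3, e4] at hs
  linarith

variable [IsTriangulated D] {B}

theorem WeakSemistable.sub {t : ℝ} {E F G : D} (hE : B.WeakSemistable t E) {f : F ⟶ E}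
    {g : E ⟶ G} (hfg : IsShortExact σ.ADag f g) (hE0 : 0 < σ.rk (cls cl E))
    (hF0 : 0 ≤ σ.rk (cls cl F))
    (h : σ.rk (cls cl F) * B.reDag t (cls cl E) = σ.rk (cls cl E) * B.reDag t (cls cl F)) :
    B.WeakSemistable t F := by
  obtain ⟨hF, -, hG, k, hT⟩ := hfg
  refine ⟨hF, ?_⟩
  rintro F' F'' a b ⟨hF', -, hF'', c, hT'⟩
  obtain ⟨C, p, q, i, j, l, h1, h2⟩ := exists_triangle_of_comp_left hT' hT
  have h3 := hE.2 (a ≫ f) p ⟨hF', hE.1, σ.ADag_ext h2 hF'' hG, q, h1⟩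
  refine le_of_mul_le_mul_left ?_ hE0
  calc σ.rk (cls cl E) * (σ.rk (cls cl F') * B.reDag t (cls cl F))
      = σ.rk (cls cl F) * (σ.rk (cls cl F') * B.reDag t (cls cl E)) := by
        linear_combination -(σ.rk (cls cl F')) * h
    _ ≤ σ.rk (cls cl F) * (σ.rk (cls cl E) * B.reDag t (cls cl F')) :=
        mul_le_mul_of_nonneg_left h3 hF0
    _ = _ := by ring

theorem WeakSemistable.quotient {t : ℝ} {E F G : D} (hE : B.WeakSemistable t E) {f : F ⟶ E}
    {g : E ⟶ G} (hfg : IsShortExact σ.ADag f g) (hE0 : 0 < σ.rk (cls cl E))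
    (hG0 : 0 ≤ σ.rk (cls cl G))
    (h : σ.rk (cls cl F) * B.reDag t (cls cl E) = σ.rk (cls cl E) * B.reDag t (cls cl F)) :
    B.WeakSemistable t G := by
  obtain ⟨hF, -, hG, k, hT⟩ := hfg
  refine ⟨hG, ?_⟩
  rintro G' G'' a b ⟨hG', -, hG'', c, hT'⟩
  obtain ⟨K, p, q, i, j, l, h1, h2, -⟩ := exists_triangle_of_comp_right hT hT'
  have h3 := hE.2 p (g ≫ b) ⟨σ.ADag_ext h2 hF hG', hE.1, hG'', q, h1⟩
  have hc : cls cl E = cls cl F + cls cl G := cls_triangle hT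
  have hc' : cls cl K = cls cl F + cls cl G' := cls_triangle h2
  have hr : B.reDag t (cls cl E) = B.reDag t (cls cl F) + B.reDag t (cls cl G) := by
    rw [hc, reDag_add]
  have hr2 : σ.rk (cls cl E) = σ.rk (cls cl F) + σ.rk (cls cl G) := by rw [hc, map_add]
  rw [hc', map_add, reDag_add] at h3
  refine le_of_mul_le_mul_left ?_ hE0
  calc σ.rk (cls cl E) * (σ.rk (cls cl G') * B.reDag t (cls cl G))
      = σ.rk (cls cl G) * (σ.rk (cls cl G') * B.reDag t (cls cl E)) := by
        linear_combination (σ.rk (cls cl G')) * h - σ.rk (cls cl G') * σ.rk (cls cl E) * hr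
          + σ.rk (cls cl G') * B.reDag t (cls cl E) * hr2
    _ ≤ σ.rk (cls cl G) * (σ.rk (cls cl E) * B.reDag t (cls cl G')) :=
        mul_le_mul_of_nonneg_left (by linarith) hG0
    _ = _ := by ring

omit [IsTriangulated D] in
-- The limit `t → 0`: the inequality has the form `a + t b ≤ 0`. If `a > 0`, some `t ≤ a / (-2 b)`
-- leaves at least `a / 2`.
theorem le_of_forall_weakSemistable {t₀ : ℝ} (ht₀ : 0 < t₀) {E F G : D}
    (hE : ∀ t, 0 < t → t ≤ t₀ → B.WeakSemistable t E) {f : F ⟶ E} {g : E ⟶ G}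
    (hfg : IsShortExact σ.ADag f g) :
    σ.rk (cls cl F) * σ.im (cls cl E) ≤ σ.rk (cls cl E) * σ.im (cls cl F) := by
  by_contra hlt
  rw [not_le] at hlt
  set a := σ.rk (cls cl F) * σ.im (cls cl E) - σ.rk (cls cl E) * σ.im (cls cl F) with ha
  set b := σ.rk (cls cl F) * B.dI (cls cl E) - σ.rk (cls cl E) * B.dI (cls cl F) with hb
  have ha0 : 0 < a := by linarith
  have key : ∀ t, 0 < t → t ≤ t₀ → a + t * b ≤ 0 := by
    intro t h1 h2
    have := (hE t h1 h2).2 f g hfg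
    unfold reDag at this
    rw [ha, hb]
    linarith
  have hb0 : b < 0 := by
    have := key t₀ ht₀ le_rfl
    by_contra hb0
    rw [not_lt] at hb0
    nlinarith
  have h1 := key (min t₀ (a / (2 * -b))) (lt_min ht₀ (by apply div_pos <;> linarith))
    (min_le_left _ _)
  have h2 : min t₀ (a / (2 * -b)) * (-b) ≤ a / (2 * -b) * (-b) :=
    mul_le_mul_of_nonneg_right (min_le_right _ _) (by linarith)
  have h3 : a / (2 * -b) * (-b) = a / 2 := by
    have := hb0.ne
    field_simp
  linarith

omit [IsTriangulated D] in
-- The limit inequality says that `E'` has slope at least that of `A₁`, while all its factors have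
-- smaller slope. Hence `E'` has class zero and `E` has the class of the semistable `A₁`. The
-- condition `h0` excludes `Z(A₁) = 0`, where `h` is vacuous.
theorem nonneg_of_first_factor (hQ : σ.IsSupportForm Q) {E A₁ E' : D} (hA : σ.ssPos A₁)
    (hc : cls cl E = cls cl A₁ + cls cl E')
    (hE' : ExtClosure (σ.ssLT (slope cl σ.Z A₁)) E')
    (h : σ.rk (cls cl A₁) * σ.im (cls cl E) ≤ σ.rk (cls cl E) * σ.im (cls cl A₁))
    (h0 : σ.im (cls cl A₁) ≠ 0 ∨ σ.rk (cls cl A₁) ≠ 0) :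
    0 ≤ σ.qVal Q (cls cl E) ∧ 0 ≤ B.Δ (cls cl E) := by
  suffices cls cl E' = 0 by
    rw [hc, this, add_zero]
    exact ⟨hQ.nonneg _ hA.1, B.Δ_nonneg_of_semistable hA.1⟩
  rw [hc, map_add, map_add] at h
  have hi := σ.im_cls_nonneg hA.1.1
  by_cases him : σ.im (cls cl A₁) = 0
  · have hs : slope cl σ.Z A₁ = ⊤ := slopeOf_of_im_eq_zero him
    rw [hs] at hE'
    obtain ⟨h1, h2⟩ := σ.cls_of_ssLT_top hE'
    have hr := (σ.rk_im_of_ssPos hA).1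
    have hr' : 0 < σ.rk (cls cl A₁) := lt_of_le_of_ne hr (Ne.symm (h0.resolve_left (not_not.2 him)))
    rw [him, zero_add, mul_zero] at h
    exact h2 (le_antisymm (nonpos_of_mul_nonpos_right h hr') h1)
  · rw [σ.slope_eq_coe him] at hE'
    obtain ⟨h1, h2, h3⟩ := σ.cls_of_ssLT_coe hE'
    have hi' : 0 < σ.im (cls cl A₁) := lt_of_le_of_ne hi (Ne.symm him)
    refine h3 (le_antisymm h2 ?_)
    rw [div_mul_eq_mul_div, div_le_iff₀ hi']
    linarith

/-- Objects that are semistable for all small parameters satisfy the inequalities. -/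
theorem nonneg_of_forall_weakSemistable (hQ : σ.IsSupportForm Q) {t₀ : ℝ} (ht₀ : 0 < t₀) {E : D}
    (hE : ∀ t, 0 < t → t ≤ t₀ → B.WeakSemistable t E) (hr : 0 < σ.rk (cls cl E)) :
    0 ≤ σ.qVal Q (cls cl E) ∧ 0 ≤ B.Δ (cls cl E) := by
  have hED : σ.ADag E := (hE t₀ ht₀ le_rfl).1
  by_cases hEA : σ.A E
  · have hE0 : ¬ IsZero E := fun h => by rw [cls_isZero h, map_zero] at hr; exact lt_irrefl _ hr
    obtain ⟨A₁, E', f, g, h, hT, hA, hA0, hE', hpos⟩ :=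
      exists_first_factor_of_homPos hEA hE0 (σ.homPos_of_ADag hED)
    have hE'A := σ.heart_of_ssLT hE'
    have hAD : σ.ADag A₁ := σ.ADag_of_ssPos (.of hA)
    have hE'D : σ.ADag E' := σ.ADag_of_ssPos (extClosure_ssPos_of_homPos hE'A hpos)
    have hfg : IsShortExact σ.ADag f g := ⟨hAD, hED, hE'D, h, hT⟩
    have hc : cls cl E = cls cl A₁ + cls cl E' := cls_triangle hT
    by_cases h0 : σ.im (cls cl A₁) ≠ 0 ∨ σ.rk (cls cl A₁) ≠ 0
    · exact nonneg_of_first_factor hQ hA hc hE' (le_of_forall_weakSemistable ht₀ hE hfg) h0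
    -- Now `A₁` lies in `𝒞`, and semistability at `t₀` forces `ΔI(A₁) = 0`. So `Z†_t(A₁) = 0` for
    -- all `t`, and `E` may be replaced by `E' = E/A₁`.
    obtain ⟨hi0, hr0⟩ := not_or.1 h0
    rw [not_not] at hi0 hr0
    have hC := σ.C_of_rk_im hA.1.1 hr0 hi0
    have hdI : B.dI (cls cl A₁) = 0 := by
      refine (B.im_dI_eq_zero hQ ht₀ hAD hr0 ?_).2
      have := (hE t₀ ht₀ le_rfl).2 f g hfg
      rw [hr0, zero_mul] at this
      exact nonneg_of_mul_nonneg_right this hr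
    have hre : ∀ t, B.reDag t (cls cl A₁) = 0 := fun t => by
      rw [reDag, hi0, hdI, mul_zero, add_zero]
    have hr' : σ.rk (cls cl E) = σ.rk (cls cl E') := by rw [hc, map_add, hr0, zero_add]
    have hE'ss : ∀ t, 0 < t → t ≤ t₀ → B.WeakSemistable t E' := fun t h1 h2 =>
      (hE t h1 h2).quotient hfg hr (by rw [← hr']; exact hr.le) (by rw [hr0, hre]; ring)
    have hE'0 : ¬ IsZero E' := fun h => by
      rw [hr', cls_isZero h, map_zero] at hr; exact lt_irrefl _ hr
    obtain ⟨A₂, E'', f', g', h', hT', hA', hA0', hE'', hpos'⟩ :=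
      exists_first_factor_of_homPos hE'A hE'0 hpos
    have hfg' : IsShortExact σ.ADag f' g' := ⟨σ.ADag_of_ssPos (.of hA'), hE'D,
      σ.ADag_of_ssPos (extClosure_ssPos_of_homPos (σ.heart_of_ssLT hE'') hpos'), h', hT'⟩
    -- The factors of `E'` have slope below `⊤`, so a subobject of slope `⊤` maps to it by zero.
    -- Thus the reduction is needed only once.
    have hsl : σ.im (cls cl A₂) ≠ 0 := fun him => hA0' (by
      have hs : slope cl σ.Z A₂ = ⊤ := by rw [slope_eq_slopeOf]; exact slopeOf_of_im_eq_zero him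
      have hs1 : slope cl σ.Z A₁ = ⊤ := by rw [slope_eq_slopeOf]; exact slopeOf_of_im_eq_zero hi0
      obtain rfl : f' = 0 := σ.hom_ssLT_eq_zero hA'.1 (by rw [hs, hs1]) hE' f'
      exact isZero_of_mono_zero σ.tstr hT' hA'.1.1 (σ.heart_of_ssLT hE''))
    obtain ⟨k1, k2⟩ := nonneg_of_first_factor (B := B) hQ hA' (cls_triangle hT') hE''
      (le_of_forall_weakSemistable ht₀ hE'ss hfg') (Or.inl hsl)
    refine ⟨?_, ?_⟩
    · rwa [hc, add_comm, qVal_add_of_mem _ (σ.cls_mem_Γ₀ hC)]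
    · rw [Δ_eq] at k2 ⊢
      rw [hc]
      simp only [map_add, hr0, hi0, hdI, B.dR_eq_zero hC, zero_add]
      exact k2
  · obtain ⟨U, F, T, E', f, g, h, a, b, c, hT, hT', hU, hs, hF, hTp⟩ :=
      σ.exists_first_factor_of_ADag hED hEA
    have hUD : σ.ADag (U⟦(1 : ℤ)⟧) :=
      (σ.ADag_iff _).2 (.of (Or.inr ⟨U, hU, hs, ⟨Iso.refl _⟩⟩))
    have hE'D : σ.ADag E' := σ.ADag_ext hT' (σ.ADag_shift_of_ssLT hs hF) (σ.ADag_of_ssPos hTp)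
    have hle := le_of_forall_weakSemistable ht₀ hE ⟨hUD, hED, hE'D, h, hT⟩
    have hc : cls cl E = - cls cl U + (- cls cl F + cls cl T) := by
      rw [cls_triangle hT, cls_triangle hT', cls_shift, cls_shift]
    obtain ⟨hU1, hU2⟩ := σ.rk_im_of_slope_nonpos hU hs
    obtain ⟨hT1, hT2, hT3⟩ := B.cls_of_ssPos hTp
    rw [σ.slope_eq_coe hU2.ne'] at hF
    obtain ⟨hF1, hF2, hF3⟩ := σ.cls_of_ssLT_coe hF
    set m := σ.rk (cls cl U) / σ.im (cls cl U) with hm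
    have hmU : σ.rk (cls cl U) = m * σ.im (cls cl U) := by rw [hm]; field_simp
    have hm0 : m ≤ 0 := div_nonpos_of_nonpos_of_nonneg hU1 hU2.le
    rw [hc, cls_shift] at hle
    simp only [map_add, map_neg, hmU] at hle
    -- The sum of the non-negative terms `m · im F - rk F`, `rk T` and `-m · im T` is at most `0`,
    -- so all vanish. Thus `F` has class zero and `T` has rank zero, with class in `Γ₀`.
    have hle' : m * σ.im (cls cl F) - σ.rk (cls cl F) + σ.rk (cls cl T)
        - m * σ.im (cls cl T) ≤ 0 := by
      refine nonpos_of_mul_nonpos_right (a := σ.im (cls cl U)) ?_ hU2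
      linarith
    have hmT : m * σ.im (cls cl T) ≤ 0 := mul_nonpos_of_nonpos_of_nonneg hm0 hT1
    have hF0 := hF3 (by linarith)
    obtain ⟨g1, g2, g3, g4⟩ := hT3 (by linarith)
    rw [hF0, neg_zero, zero_add] at hc
    refine ⟨?_, ?_⟩
    · rw [hc, qVal_add_of_mem _ g1, qVal_neg]
      exact hQ.nonneg _ hU
    -- Here `Δ(E) = Δ(U) - im U · dI T`, and `dI T ≤ 0`.
    · have k := B.Δ_nonneg_of_semistable hU
      rw [Δ_eq] at k ⊢
      rw [hc]
      have hrT : σ.rk (cls cl T) = 0 := by linarith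
      simp only [map_add, map_neg, hrT, g2, g4]
      nlinarith [mul_nonneg hU2.le (neg_nonneg.2 g3)]

end BGInequality

end VeryWeakPreStability

end

end VWStab

/-! ### Real quadratic forms: compactness, lattice points, orthogonal decomposition. -/

namespace VWStab

theorem quadraticForm_continuous {V : Type*} [NormedAddCommGroup V] [NormedSpace ℝ V]
    [FiniteDimensional ℝ V] (q : QuadraticForm ℝ V) : Continuous q := by
  let A : V →L[ℝ] V →L[ℝ] ℝ :=
    ((LinearMap.toContinuousLinearMap : (V →ₗ[ℝ] ℝ) ≃ₗ[ℝ] (V →L[ℝ] ℝ)).toLinearMap ∘ₗ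
      QuadraticMap.associated q).toContinuousLinearMap
  have h : ∀ x, q x = A x x := fun x => (QuadraticMap.associated_eq_self_apply ℝ q x).symm
  rw [show (q : V → ℝ) = fun x => A x x from funext h]
  exact A.continuous.clm_apply continuous_id

/-- If `q` is negative definite on the kernels of `(L₁, L₂ + s L₃)` for `s` in a compact interval,
then the vectors with `q ≥ 0` on which these maps are bounded are bounded. -/
theorem exists_norm_bound {V : Type*} [NormedAddCommGroup V] [NormedSpace ℝ V]
    [FiniteDimensional ℝ V] (q : QuadraticForm ℝ V) (L₁ L₂ L₃ : V →ₗ[ℝ] ℝ) (a b C : ℝ)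
    (hq : ∀ s ∈ Set.Icc a b, ∀ v, L₁ v = 0 → L₂ v + s * L₃ v = 0 → v ≠ 0 → q v < 0) :
    ∃ R, ∀ s ∈ Set.Icc a b, ∀ v, 0 ≤ q v → |L₁ v| ≤ C → |L₂ v + s * L₃ v| ≤ C → ‖v‖ ≤ R := by
  have c1 := L₁.continuous_of_finiteDimensional
  have c2 := L₂.continuous_of_finiteDimensional
  have c3 := L₃.continuous_of_finiteDimensional
  have hK : IsCompact ((Set.Icc a b ×ˢ Metric.sphere (0 : V) 1) ∩ {p : ℝ × V | 0 ≤ q p.2}) :=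
    (isCompact_Icc.prod (isCompact_sphere _ _)).inter_right
      (isClosed_le continuous_const ((quadraticForm_continuous q).comp continuous_snd))
  have hf : Continuous fun p : ℝ × V => |L₁ p.2| + |L₂ p.2 + p.1 * L₃ p.2| := by fun_prop
  -- On unit vectors with `q ≥ 0` the two functionals have no common zero, so by compactness the sum
  -- of their absolute values is at least some `ε > 0`. Rescaling gives the bound `2 C / ε`.
  obtain ⟨ε, hε, hεK⟩ := hK.exists_forall_le' hf.continuousOn (a := 0) (by
    rintro ⟨s, v⟩ ⟨⟨hs, hv⟩, hqv⟩
    have hv0 : v ≠ 0 := by rintro rfl; simp at hv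
    refine lt_of_le_of_ne (by positivity) fun h => ?_
    have h1 : |L₁ v| = 0 := by
      have := abs_nonneg (L₁ v); have := abs_nonneg (L₂ v + s * L₃ v); simp only at h; linarith
    have h2 : |L₂ v + s * L₃ v| = 0 := by simp only at h; linarith
    exact absurd (hq s hs v (abs_eq_zero.1 h1) (abs_eq_zero.1 h2) hv0) (not_lt.2 hqv))
  refine ⟨max 0 (2 * C / ε), fun s hs v hqv h1 h2 => ?_⟩
  by_cases hv : v = 0
  · rw [hv, norm_zero]; exact le_max_left _ _
  have hn : 0 < ‖v‖ := norm_pos_iff.2 hv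
  have h3 := hεK (s, ‖v‖⁻¹ • v) ⟨⟨hs, by simp [norm_smul, hn.ne']⟩, by
    change 0 ≤ q (‖v‖⁻¹ • v)
    rw [QuadraticMap.map_smul]
    exact smul_nonneg (by positivity) hqv⟩
  refine le_max_of_le_right ?_
  have h4 : |L₁ (‖v‖⁻¹ • v)| + |L₂ (‖v‖⁻¹ • v) + s * L₃ (‖v‖⁻¹ • v)| =
      ‖v‖⁻¹ * (|L₁ v| + |L₂ v + s * L₃ v|) := by
    simp only [map_smul, smul_eq_mul]
    rw [show ‖v‖⁻¹ * L₂ v + s * (‖v‖⁻¹ * L₃ v) = ‖v‖⁻¹ * (L₂ v + s * L₃ v) by ring, abs_mul,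
      abs_mul, abs_of_pos (inv_pos.2 hn)]
    ring
  simp only at h3
  rw [h4, ← div_eq_inv_mul, le_div_iff₀ hn] at h3
  rw [le_div_iff₀ hε]
  linarith

theorem finite_int_of_norm_le {ι : Type*} [Fintype ι] (R : ℝ) :
    {m : ι → ℤ | ‖fun i => (m i : ℝ)‖ ≤ R}.Finite := by
  classical
  refine (Set.finite_Icc (fun _ : ι => -⌈R⌉) (fun _ => ⌈R⌉)).subset fun m hm => ?_
  have h : ∀ i, |(m i : ℝ)| ≤ R := fun i => (norm_le_pi_norm (fun i => (m i : ℝ)) i).trans hm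
  refine ⟨fun i => ?_, fun i => ?_⟩
  · have := (abs_le.1 (h i)).1
    have h2 := Int.le_ceil R
    have h3 : (-⌈R⌉ : ℝ) ≤ m i := by linarith
    exact_mod_cast h3
  · have h3 : (m i : ℝ) ≤ ⌈R⌉ := (abs_le.1 (h i)).2.trans (Int.le_ceil R)
    exact_mod_cast h3

/-- In `ℝ ⊗ M` only finitely many elements of `M` satisfy the bounds of `exists_norm_bound`. -/
theorem finite_lattice_of_bounded {M : Type*} [AddCommGroup M] [Module.Free ℤ M]
    [Module.Finite ℤ M] (q : QuadraticForm ℝ (ℝ ⊗[ℤ] M)) (L₁ L₂ L₃ : ℝ ⊗[ℤ] M →ₗ[ℝ] ℝ)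
    (a b C : ℝ)
    (hq : ∀ s ∈ Set.Icc a b, ∀ v, L₁ v = 0 → L₂ v + s * L₃ v = 0 → v ≠ 0 → q v < 0) :
    {v : ℝ ⊗[ℤ] M | (∃ x : M, v = 1 ⊗ₜ x) ∧ 0 ≤ q v ∧ ∃ s ∈ Set.Icc a b, |L₁ v| ≤ C ∧
      |L₂ v + s * L₃ v| ≤ C}.Finite := by
  let β := Module.Free.chooseBasis ℤ M
  let e := (β.baseChange ℝ).equivFun
  obtain ⟨R, hR⟩ := exists_norm_bound (q.comp e.symm.toLinearMap) (L₁ ∘ₗ e.symm.toLinearMap)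
    (L₂ ∘ₗ e.symm.toLinearMap) (L₃ ∘ₗ e.symm.toLinearMap) a b C (fun s hs v h1 h2 hv =>
      hq s hs _ h1 h2 (by simpa using hv))
  refine ((finite_int_of_norm_le R).image
    (fun m : _ → ℤ => (1 : ℝ) ⊗ₜ[ℤ] β.equivFun.symm m)).subset ?_
  rintro _ ⟨⟨x, rfl⟩, hx, s, hs, h1, h2⟩
  refine ⟨β.equivFun x, ?_, by simp⟩
  have he : e (1 ⊗ₜ x) = fun i => ((β.equivFun x i : ℤ) : ℝ) := by
    funext i
    simp [e]
  have := hR s hs (e (1 ⊗ₜ x)) (by simpa using hx) (by simpa using h1) (by simpa using h2)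
  rwa [he] at this

/-- A quadratic form that is negative definite on the kernel of `L` is bounded by a multiple of
`(Im L)²` on the space where `Re L = 0`. -/
theorem exists_le_mul_im_sq {V : Type*} [AddCommGroup V] [Module ℝ V] [FiniteDimensional ℝ V]
    (q : QuadraticForm ℝ V) (L : V →ₗ[ℝ] ℂ) (hq : ∀ x, L x = 0 → x ≠ 0 → q x < 0) :
    ∃ K > 0, ∀ x, (L x).re = 0 → q x ≤ K * (L x).im ^ 2 := by
  have hq' : ∀ x, L x = 0 → q x ≤ 0 := fun x hx => by
    by_cases h : x = 0
    · rw [h, map_zero]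
    · exact (hq x hx h).le
  by_cases hv : ∃ v, (L v).re = 0 ∧ (L v).im ≠ 0
  · obtain ⟨v, hv1, hv2⟩ := hv
    let φ : LinearMap.ker L →ₗ[ℝ] Module.Dual ℝ (LinearMap.ker L) :=
      (LinearMap.lcomp ℝ ℝ (LinearMap.ker L).subtype) ∘ₗ q.polarBilin ∘ₗ (LinearMap.ker L).subtype
    have hφ : ∀ x y, φ x y = QuadraticMap.polar q x y := fun _ _ => rfl
    have hinj : Function.Injective φ := by
      rw [injective_iff_map_eq_zero]
      intro x hx
      have h1 : QuadraticMap.polar q (x : V) x = 0 := by rw [← hφ, hx]; rfl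
      rw [QuadraticMap.polar_self, two_nsmul] at h1
      by_contra hx0
      have := hq x x.2 (fun h => hx0 (Subtype.ext h))
      linarith
    have hsurj : Function.Surjective φ :=
      (LinearMap.injective_iff_surjective_of_finrank_eq_finrank
        (Subspace.dual_finrank_eq).symm).1 hinj
    -- `n` is the `q`-orthogonal projection of `v` to `ker L`, on which `q` is definite. Then `u` is
    -- orthogonal to `ker L` with `L u = i`, and `K` can be any positive number at least `q u`.
    obtain ⟨n, hn⟩ := hsurj ((q.polarBilin v) ∘ₗ (LinearMap.ker L).subtype)
    set u := (L v).im⁻¹ • (v - n) with hu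
    have hLn : L n = 0 := n.2
    have hLu : L u = Complex.I := by
      rw [hu, map_smul, map_sub, hLn, sub_zero]
      apply Complex.ext <;> simp [hv1, hv2]
    have hpol : ∀ y, L y = 0 → QuadraticMap.polar q u y = 0 := by
      intro y hy
      have h1 : QuadraticMap.polar q (n : V) y = QuadraticMap.polar q v y :=
        LinearMap.congr_fun hn ⟨y, hy⟩
      rw [hu, QuadraticMap.polar_smul_left, QuadraticMap.polar_sub_left, h1, sub_self, smul_zero]
    refine ⟨max (q u) 0 + 1, by positivity, fun x hx => ?_⟩
    have hy : L (x - (L x).im • u) = 0 := by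
      rw [map_sub, map_smul, hLu]
      apply Complex.ext <;> simp [hx]
    have hdec : q x = (L x).im ^ 2 * q u + q (x - (L x).im • u) := by
      conv_lhs => rw [show x = (L x).im • u + (x - (L x).im • u) by abel]
      rw [QuadraticMap.map_add q, QuadraticMap.polar_smul_left, hpol _ hy, QuadraticMap.map_smul]
      simp [sq]
    have h1 := hq' _ hy
    have h2 : q u ≤ max (q u) 0 + 1 := by linarith [le_max_left (q u) 0]
    have h3 := mul_le_mul_of_nonneg_left h2 (sq_nonneg (L x).im)
    linarith
  · refine ⟨1, one_pos, fun x hx => ?_⟩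
    have him : (L x).im = 0 := by
      by_contra him
      exact hv ⟨x, hx, him⟩
    have := hq' x (Complex.ext hx him)
    rw [him]
    simpa using this

/-- Denominators move across the tensor product. Consequently the multiplication map to `ℝ` is
injective. -/
theorem tensor_rat_eq (x : ℝ ⊗[ℤ] ℚ) : ∃ r : ℝ, x = r ⊗ₜ 1 := by
  induction x with
  | zero => exact ⟨0, by simp⟩
  | tmul r a =>
    refine ⟨r * a, ?_⟩
    have h1 : a = a.num • ((a.den : ℚ)⁻¹) := by
      rw [zsmul_eq_mul, ← div_eq_mul_inv, Rat.num_div_den]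
    have hd : (a.den : ℝ) ≠ 0 := by exact_mod_cast a.den_nz
    have h3 : r = (a.den : ℤ) • (r / a.den) := by
      simp only [zsmul_eq_mul]; push_cast; field_simp
    have h4 : (a.den : ℤ) • ((a.den : ℚ)⁻¹) = 1 := by
      simp only [zsmul_eq_mul]; push_cast; field_simp
    have h5 : r * a = a.num • (r / a.den) := by
      conv_lhs => rw [← Rat.num_div_den a]
      simp only [zsmul_eq_mul]; push_cast; field_simp
    rw [h5]
    conv_lhs => rw [h1, h3]
    rw [TensorProduct.tmul_smul, TensorProduct.smul_tmul, h4, TensorProduct.smul_tmul']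
  | add x y hx hy =>
    obtain ⟨r, rfl⟩ := hx
    obtain ⟨s, rfl⟩ := hy
    exact ⟨r + s, (TensorProduct.add_tmul _ _ _).symm⟩

end VWStab

/-! ### The space `(Γ/Γ₀†) ⊗ ℝ` and negative definiteness of `Δ_{k,t}`. -/

namespace VWStab

variable {D : Type u} [Category.{v} D] [Preadditive D] [HasZeroObject D] [HasShift D ℤ]
  [∀ n : ℤ, (shiftFunctor D n).Additive] [Pretriangulated D]
  {Γ : Type w} [AddCommGroup Γ] {cl : K0 D →+ Γ}

theorem mem_saturation_of_zsmul_mem {S : Set Γ} {n : ℤ} (hn : n ≠ 0) {x : Γ}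
    (hx : n • x ∈ saturation S) : x ∈ saturation S := by
  obtain ⟨m, hm, h⟩ := hx
  exact ⟨m * n, mul_ne_zero hm hn, by rwa [mul_smul]⟩

namespace VeryWeakPreStability

variable {σ : VeryWeakPreStability cl} {Q : QuadraticForm ℝ (ℝ ⊗[ℤ] (Γ ⧸ σ.Γ₀))}

namespace BGInequality

variable (B : σ.BGInequality)

/-- Both `Γ₀` and `ker ΔI` are saturated. For finitely generated `Γ` the quotient is therefore a
lattice, as the finiteness of walls requires. -/
theorem isTorsionFree_quotient_Γ₀Dag : Module.IsTorsionFree ℤ (Γ ⧸ B.Γ₀Dag) := by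
  refine Module.IsTorsionFree.of_smul_eq_zero fun n x h => ?_
  obtain ⟨x, rfl⟩ := B.Γ₀Dag.mkQ_surjective x
  rw [← map_smul, Submodule.mkQ_apply, Submodule.Quotient.mk_eq_zero] at h
  rw [Submodule.mkQ_apply, Submodule.Quotient.mk_eq_zero]
  by_cases hn : n = 0
  · exact Or.inl hn
  · obtain ⟨h1, h2⟩ := h
    refine Or.inr ⟨mem_saturation_of_zsmul_mem hn h1, ?_⟩
    have h3 : B.ΔI (n • x) = 0 := h2
    rw [map_smul, smul_eq_zero] at h3
    exact h3.resolve_left hn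

/-- The class in `(Γ/Γ₀†) ⊗ ℝ` of an element of `Γ`. -/
noncomputable def toVDag (x : Γ) : B.VDag := 1 ⊗ₜ[ℤ] B.Γ₀Dag.mkQ x

theorem toVDag_add (x y : Γ) : B.toVDag (x + y) = B.toVDag x + B.toVDag y := by
  simp only [toVDag, map_add, TensorProduct.tmul_add]

/-- The real-linear extension of `rk`. -/
noncomputable def rkV : B.VDag →ₗ[ℝ] ℝ := -(Complex.reLm ∘ₗ σ.Zbar ∘ₗ B.projDag)

/-- The real-linear extension of `im`. -/
noncomputable def imV : B.VDag →ₗ[ℝ] ℝ := Complex.imLm ∘ₗ σ.Zbar ∘ₗ B.projDag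

/-- The real-linear extension of `dI`. -/
noncomputable def dIV : B.VDag →ₗ[ℝ] ℝ := B.ratVDag B.ΔI B.Γ₀Dag_le_ker_ΔI

theorem projDag_toVDag (x : Γ) : B.projDag (B.toVDag x) = 1 ⊗ₜ[ℤ] σ.Γ₀.mkQ x := by
  rfl

theorem rkV_toVDag (x : Γ) : B.rkV (B.toVDag x) = σ.rk x := by
  simp only [rkV, LinearMap.neg_apply, LinearMap.comp_apply, projDag_toVDag, Zbar_tmul, rk_apply]
  rfl

theorem imV_toVDag (x : Γ) : B.imV (B.toVDag x) = σ.im x := by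
  simp only [imV, LinearMap.comp_apply, projDag_toVDag, Zbar_tmul, im_apply]
  rfl

theorem dIV_toVDag (x : Γ) : B.dIV (B.toVDag x) = B.dI x := by
  simp only [dIV, ratVDag, toVDag, LinearMap.liftBaseChange_tmul, one_smul]
  rfl

theorem ZVDag_eq : B.ZVDag = σ.Zbar ∘ₗ B.projDag := by
  refine TensorProduct.AlgebraTensorModule.ext fun r x => ?_
  obtain ⟨x, rfl⟩ := B.Γ₀Dag.mkQ_surjective x
  simp only [ZVDag, LinearMap.liftBaseChange_tmul, projDag, Zbar]
  rfl

theorem linearMap_ext_toVDag {M : Type*} [AddCommGroup M] [Module ℝ M] {f g : B.VDag →ₗ[ℝ] M}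
    (h : ∀ x, f (B.toVDag x) = g (B.toVDag x)) : f = g := by
  refine TensorProduct.AlgebraTensorModule.ext fun r x => ?_
  obtain ⟨x, rfl⟩ := B.Γ₀Dag.mkQ_surjective x
  have h1 : r ⊗ₜ[ℤ] B.Γ₀Dag.mkQ x = r • B.toVDag x := by
    rw [toVDag, TensorProduct.smul_tmul', smul_eq_mul, mul_one]
  rw [h1, map_smul, map_smul, h]

theorem ZDagBar_toVDag (t : ℝ) (x : Γ) : B.ZDagBar t (B.toVDag x) = B.ZDag t x := by
  simp only [ZDagBar, toVDag, LinearMap.liftBaseChange_tmul, one_smul]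
  rfl

theorem ZDagBar_im (t : ℝ) (v : B.VDag) : (B.ZDagBar t v).im = B.rkV v := by
  have : Complex.imLm ∘ₗ B.ZDagBar t = B.rkV := B.linearMap_ext_toVDag fun x => by
    rw [LinearMap.comp_apply, ZDagBar_toVDag, rkV_toVDag]
    exact B.ZDag_im t x
  exact LinearMap.congr_fun this v

theorem ZDagBar_re (t : ℝ) (v : B.VDag) : (B.ZDagBar t v).re = B.imV v + t * B.dIV v := by
  have : Complex.reLm ∘ₗ B.ZDagBar t = B.imV + t • B.dIV := B.linearMap_ext_toVDag fun x => by
    rw [LinearMap.comp_apply, ZDagBar_toVDag, LinearMap.add_apply, LinearMap.smul_apply,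
      imV_toVDag, dIV_toVDag]
    exact B.ZDag_re t x
  exact LinearMap.congr_fun this v

theorem ΔForm_apply (v : B.VDag) :
    B.ΔForm v = -(B.rkV v * B.ratVDag B.ΔR B.Γ₀Dag_le_ker_ΔR v) + B.imV v * B.dIV v := by
  simp only [ΔForm, add_apply, QuadraticMap.linMulLin_apply, LinearMap.comp_apply,
    ZVDag_eq, rkV, imV, dIV, LinearMap.neg_apply]
  ring

/-- `Γ/Γ₀†` embeds into `Γ/Γ₀ × ℚ`, and by flatness of `ℝ` the embedding survives tensoring. -/
theorem eq_zero_of_projDag_of_dIV {v : B.VDag} (h1 : B.projDag v = 0) (h2 : B.dIV v = 0) :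
    v = 0 := by
  let φ : (Γ ⧸ B.Γ₀Dag) →ₗ[ℤ] (Γ ⧸ σ.Γ₀) × ℚ :=
    (Submodule.factor (inf_le_left : B.Γ₀Dag ≤ σ.Γ₀)).prod
      (B.Γ₀Dag.liftQ B.ΔI B.Γ₀Dag_le_ker_ΔI)
  have hφ : Function.Injective φ := by
    rw [injective_iff_map_eq_zero]
    intro x hx
    obtain ⟨x, rfl⟩ := B.Γ₀Dag.mkQ_surjective x
    obtain ⟨h3, h4⟩ := Prod.ext_iff.1 hx
    have h3' : σ.Γ₀.mkQ x = 0 := h3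
    have h4' : B.ΔI x = 0 := h4
    rw [Submodule.mkQ_apply, Submodule.Quotient.mk_eq_zero] at *
    exact ⟨h3', h4'⟩
  have hflat : Function.Injective (φ.lTensor ℝ) :=
    Module.Flat.lTensor_preserves_injective_linearMap φ hφ
  apply hflat
  rw [map_zero]
  apply (TensorProduct.prodRight ℤ ℤ ℝ (Γ ⧸ σ.Γ₀) ℚ).injective
  rw [map_zero]
  have e1 : ∀ w : B.VDag, (TensorProduct.prodRight ℤ ℤ ℝ (Γ ⧸ σ.Γ₀) ℚ (φ.lTensor ℝ w)).1 =
      B.projDag w := by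
    intro w
    induction w using TensorProduct.induction_on with
    | zero => simp
    | tmul r x => rfl
    | add x y hx hy => simp only [map_add, Prod.fst_add, hx, hy]
  have e2 : ∀ w : B.VDag, LinearMap.liftBaseChange ℝ (Rat.castHom ℝ).toIntAlgHom.toLinearMap
      (TensorProduct.prodRight ℤ ℤ ℝ (Γ ⧸ σ.Γ₀) ℚ (φ.lTensor ℝ w)).2 = B.dIV w := by
    intro w
    induction w using TensorProduct.induction_on with
    | zero => simp
    | tmul r x => rfl
    | add x y hx hy => simp only [map_add, Prod.snd_add, hx, hy]
  refine Prod.ext ((e1 v).trans h1) ?_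
  have h5 := (e2 v).trans h2
  obtain ⟨r, hr⟩ := tensor_rat_eq (TensorProduct.prodRight ℤ ℤ ℝ (Γ ⧸ σ.Γ₀) ℚ (φ.lTensor ℝ v)).2
  rw [hr] at h5 ⊢
  rw [LinearMap.liftBaseChange_tmul] at h5
  have h6 : r = 0 := by simpa using h5
  rw [h6, TensorProduct.zero_tmul]
  rfl

theorem exists_negDefBelow [Module.Finite ℤ Γ] (hQ : σ.IsSupportForm Q) :
    ∃ k₀ : ℝ, 0 < k₀ ∧ B.NegDefBelow Q k₀ := by
  obtain ⟨K, hK, hKQ⟩ := exists_le_mul_im_sq Q σ.Zbar hQ.neg_def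
  refine ⟨1 / K, by positivity, ?_⟩
  rintro k ⟨hk, hk'⟩ t ht v hv hv0
  have h1 : B.rkV v = 0 := by rw [← B.ZDagBar_im t, hv]; rfl
  -- With `rk = 0` this turns `t Δ = t · im · dI` into `-im²`.
  have h2 : B.imV v + t * B.dIV v = 0 := by rw [← B.ZDagBar_re t, hv]; rfl
  have h3 : B.Δkt Q k t v = k * Q (B.projDag v) - (B.imV v) ^ 2 := by
    simp only [Δkt, add_apply, smul_apply, QuadraticMap.comp_apply,
      smul_eq_mul, ΔForm_apply, h1]
    linear_combination (B.imV v) * h2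
  rw [h3]
  have hre : (σ.Zbar (B.projDag v)).re = 0 := neg_eq_zero.1 h1
  by_cases him : B.imV v = 0
  · have hp : B.projDag v ≠ 0 := fun hp => hv0 (B.eq_zero_of_projDag_of_dIV hp (by
      rw [him, zero_add] at h2
      exact (mul_eq_zero.1 h2).resolve_left ht.ne'))
    have := mul_neg_of_pos_of_neg hk (hQ.neg_def _ (Complex.ext hre him) hp)
    rw [him]
    linarith
  · have h4 : Q (B.projDag v) ≤ K * (B.imV v) ^ 2 := hKQ _ hre
    have h5 : 0 < (B.imV v) ^ 2 := by positivity
    have h6 : k * K < 1 := (lt_div_iff₀ hK).1 hk'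
    have h7 := mul_le_mul_of_nonneg_left h4 hk.le
    have h8 := mul_lt_mul_of_pos_right h6 h5
    linarith

/-- Finitely many generators have a common denominator `d`; take `δ = ζ₁ / d`. -/
theorem exists_rk_discrete [Module.Finite ℤ Γ]
    (h : ∃ ζ₁ ζ₂ : ℝ, 0 < ζ₁ ∧ 0 < ζ₂ ∧ ∀ x : Γ, ∃ a b : ℚ,
      σ.Z x = ((ζ₁ * a : ℝ) : ℂ) + ((ζ₂ * b : ℝ) : ℂ) * Complex.I) :
    ∃ δ : ℝ, 0 < δ ∧ ∀ x : Γ, ∃ n : ℤ, σ.rk x = n * δ := by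
  obtain ⟨ζ, ζ', hζ, -, hZ⟩ := h
  have hrk : ∀ x, ∃ a : ℚ, σ.rk x = ζ * a := fun x => by
    obtain ⟨a, b, hab⟩ := hZ x
    refine ⟨-a, ?_⟩
    rw [rk_apply, hab]
    simp
  choose a ha using hrk
  obtain ⟨S, hS⟩ := Module.Finite.fg_top (R := ℤ) (M := Γ)
  set d : ℕ := ∏ s ∈ S, (a s).den with hd
  have hd0 : 0 < d := Finset.prod_pos fun s _ => (a s).den_pos
  have hd0' : (d : ℝ) ≠ 0 := by exact_mod_cast hd0.ne'
  refine ⟨ζ / d, by positivity, fun x => ?_⟩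
  have hx : x ∈ Submodule.span ℤ (S : Set Γ) := hS ▸ Submodule.mem_top
  induction hx using Submodule.span_induction with
  | mem x hx =>
    obtain ⟨c, hc⟩ := Finset.dvd_prod_of_mem (fun s => (a s).den) hx
    refine ⟨(a x).num * c, ?_⟩
    have h0 : ((a x).den : ℝ) ≠ 0 := by exact_mod_cast (a x).den_nz
    have h1 : (d : ℝ) = (a x).den * c := by rw [hd]; exact_mod_cast hc
    have h2 : (c : ℝ) ≠ 0 := by rintro h2; rw [h2, mul_zero] at h1; exact hd0' h1
    rw [ha, h1]
    conv_lhs => rw [← Rat.num_div_den (a x)]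
    push_cast
    field_simp
  | zero => exact ⟨0, by simp⟩
  | add x y _ _ hx hy =>
    obtain ⟨n, hn⟩ := hx
    obtain ⟨m, hm⟩ := hy
    exact ⟨n + m, by rw [map_add, hn, hm]; push_cast; ring⟩
  | smul c x _ hx =>
    obtain ⟨n, hn⟩ := hx
    exact ⟨c * n, by rw [map_zsmul, hn, zsmul_eq_mul]; push_cast; ring⟩

end BGInequality

end VeryWeakPreStability

end VWStab

/-! ### Wall-crossing and induction on the rank. -/

namespace VWStab

variable {D : Type u} [Category.{v} D] [Preadditive D] [HasZeroObject D] [HasShift D ℤ]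
  [∀ n : ℤ, (shiftFunctor D n).Additive] [Pretriangulated D]
  {Γ : Type w} [AddCommGroup Γ] {cl : K0 D →+ Γ}

namespace VeryWeakPreStability

variable {σ : VeryWeakPreStability cl} {Q : QuadraticForm ℝ (ℝ ⊗[ℤ] (Γ ⧸ σ.Γ₀))}

namespace BGInequality

variable (B : σ.BGInequality)

/-- The quadratic form `m Q + Δ` on `Γ/Γ₀†`. -/
noncomputable def mForm (Q : QuadraticForm ℝ (ℝ ⊗[ℤ] (Γ ⧸ σ.Γ₀))) (m : ℝ) :
    QuadraticForm ℝ B.VDag :=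
  B.Δkt Q m 1

theorem Δkt_eq_smul_mForm (m t : ℝ) : B.Δkt Q (m * t) t = t • B.mForm Q m := by
  simp only [mForm, Δkt, one_smul, smul_add, smul_smul, mul_comm]

theorem mForm_toVDag (m : ℝ) (E : D) :
    B.mForm Q m (B.toVDag (cls cl E)) = m * σ.qVal Q (cls cl E) + B.Δ (cls cl E) := by
  have := B.Δkt_clDag Q m 1 E
  rw [one_mul] at this
  exact this

variable {B}

theorem mForm_neg {k₀ : ℝ} (hk : B.NegDefBelow Q k₀) {m t : ℝ} (hm : 0 < m) (ht : 0 < t)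
    (hmt : m * t < k₀) {v : B.VDag} (h : B.ZDagBar t v = 0) (hv : v ≠ 0) : B.mForm Q m v < 0 := by
  have h1 := hk (m * t) ⟨by positivity, hmt⟩ t ht v h hv
  rw [Δkt_eq_smul_mForm, smul_apply, smul_eq_mul] at h1
  exact neg_of_mul_neg_right h1 ht.le

/-- The set of parameters for which an object is semistable is closed from the right. -/
theorem weakSemistable_of_forall_gt {t₁ t₀ : ℝ} (h : t₁ < t₀) {E : D}
    (hE : ∀ t, t₁ < t → t ≤ t₀ → B.WeakSemistable t E) : B.WeakSemistable t₁ E := by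
  refine ⟨(hE t₀ h le_rfl).1, fun F G f g hfg => ?_⟩
  have hc : ∀ x : Γ, Continuous fun t => B.reDag t x := fun x => by unfold reDag; fun_prop
  have hlim : Filter.Tendsto (fun t => σ.rk (cls cl E) * B.reDag t (cls cl F) -
      σ.rk (cls cl F) * B.reDag t (cls cl E)) (nhdsWithin t₁ (Set.Ioi t₁)) (nhds _) :=
    ((continuous_const.mul (hc _)).sub (continuous_const.mul (hc _))).continuousWithinAt
  refine sub_nonneg.1 (ge_of_tendsto hlim ?_)
  filter_upwards [Ioc_mem_nhdsGT h] with t ht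
  exact sub_nonneg.2 ((hE t ht.1 ht.2).2 f g hfg)

variable [IsTriangulated D]

/-- A destabilizing subobject of minimal rank is semistable. -/
theorem exists_weakSemistable_destabilizing (hQ : σ.IsSupportForm Q) {δ : ℝ} (hδ : 0 < δ)
    (hrk : ∀ x : Γ, ∃ n : ℤ, σ.rk x = n * δ) {t : ℝ} (ht : 0 < t) {E : D} (hE : σ.ADag E)
    (hr : 0 < σ.rk (cls cl E)) (hE' : ¬ B.WeakSemistable t E) :
    ∃ (F G : D) (f : F ⟶ E) (g : E ⟶ G), IsShortExact σ.ADag f g ∧ B.WeakSemistable t F ∧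
      σ.rk (cls cl E) * B.reDag t (cls cl F) < σ.rk (cls cl F) * B.reDag t (cls cl E) := by
  classical
  have hex : ∃ n : ℕ, ∃ (F G : D) (f : F ⟶ E) (g : E ⟶ G), IsShortExact σ.ADag f g ∧
      σ.rk (cls cl E) * B.reDag t (cls cl F) < σ.rk (cls cl F) * B.reDag t (cls cl E) ∧
      σ.rk (cls cl F) = n * δ := by
    by_contra hno
    refine hE' ⟨hE, fun F G f g hfg => ?_⟩
    by_contra hlt
    rw [not_le] at hlt
    obtain ⟨n, hn⟩ := hrk (cls cl F)
    have h0 := (B.cls_of_ADag hQ hfg.1).1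
    have hn0 : 0 ≤ n := by
      rw [hn] at h0
      exact_mod_cast nonneg_of_mul_nonneg_left h0 hδ
    lift n to ℕ using hn0
    exact hno ⟨n, F, G, f, g, hfg, hlt, by exact_mod_cast hn⟩
  obtain ⟨F, G, f, g, hfg, hlt, hn⟩ := Nat.find_spec hex
  refine ⟨F, G, f, g, hfg, ⟨hfg.1, ?_⟩, hlt⟩
  obtain ⟨hF, -, hG, k, hT⟩ := hfg
  rintro F' F'' a b ⟨hF', -, hF'', c, hT'⟩
  have hc : cls cl F = cls cl F' + cls cl F'' := cls_triangle hT'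
  have h1 := (B.cls_of_ADag hQ hF').1
  have h2 := (B.cls_of_ADag hQ hF'').1
  rcases lt_or_ge (σ.rk (cls cl F')) (σ.rk (cls cl F)) with hl | hl
  · obtain ⟨C, p, q, i, j, l, h3, h4⟩ := exists_triangle_of_comp_left hT' hT
    have hle : σ.rk (cls cl F') * B.reDag t (cls cl E) ≤
        σ.rk (cls cl E) * B.reDag t (cls cl F') := by
      by_contra hlt'
      rw [not_le] at hlt'
      obtain ⟨n, hn'⟩ := hrk (cls cl F')
      have hn0 : 0 ≤ n := by
        rw [hn'] at h1
        exact_mod_cast nonneg_of_mul_nonneg_left h1 hδ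
      lift n to ℕ using hn0
      refine Nat.find_min hex (m := n) ?_ ⟨F', C, a ≫ f, p,
        ⟨hF', hE, σ.ADag_ext h4 hF'' hG, q, h3⟩, hlt', by exact_mod_cast hn'⟩
      rw [hn, hn'] at hl
      exact_mod_cast lt_of_mul_lt_mul_right hl hδ.le
    refine le_of_mul_le_mul_left ?_ hr
    have h5 := mul_le_mul_of_nonneg_left hle (h1.trans hl.le)
    have h6 := mul_le_mul_of_nonneg_left hlt.le h1
    linarith
  -- A subobject of full rank leaves a quotient of rank zero, whose `reDag` is non-positive.
  · rw [hc, map_add] at hl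
    have h3 : σ.rk (cls cl F'') = 0 := by linarith
    have h4 := B.reDag_nonpos hQ ht hF'' h3
    rw [hc, map_add, reDag_add, h3, add_zero]
    have := mul_nonpos_of_nonneg_of_nonpos h1 h4
    linarith

omit [IsTriangulated D] in
/-- The first wall below `t₀` for an object that is not semistable for all smaller parameters. -/
theorem exists_last_unstable {t₀ : ℝ} {E : D} (hE : B.WeakSemistable t₀ E)
    (h : ∃ t, 0 < t ∧ t ≤ t₀ ∧ ¬ B.WeakSemistable t E) :
    ∃ t₁, 0 < t₁ ∧ t₁ ≤ t₀ ∧ B.WeakSemistable t₁ E ∧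
      ∀ a < t₁, ∃ t, a < t ∧ 0 < t ∧ t < t₁ ∧ ¬ B.WeakSemistable t E := by
  set S := {t | 0 < t ∧ t ≤ t₀ ∧ ¬ B.WeakSemistable t E} with hS
  have hne : S.Nonempty := h
  have hbdd : BddAbove S := ⟨t₀, fun t ht => ht.2.1⟩
  have hle : sSup S ≤ t₀ := csSup_le hne fun t ht => ht.2.1
  have hpos : 0 < sSup S := by
    obtain ⟨t, ht⟩ := hne
    exact ht.1.trans_le (le_csSup hbdd ht)
  have hss : B.WeakSemistable (sSup S) E := by
    -- `E` is semistable at the supremum of the unstable parameters: either this is `t₀`, or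
    -- semistability holds just above it and passes to the limit.
    rcases hle.eq_or_lt with h' | h'
    · rwa [h']
    · refine weakSemistable_of_forall_gt h' fun t h1 h2 => ?_
      by_contra hn
      exact absurd (le_csSup hbdd (show t ∈ S from ⟨hpos.trans h1, h2, hn⟩)) (not_le.2 h1)
  refine ⟨sSup S, hpos, hle, hss, fun a ha => ?_⟩
  obtain ⟨t, ht, hat⟩ := exists_lt_of_lt_csSup hne ha
  refine ⟨t, hat, ht.1, lt_of_le_of_ne (le_csSup hbdd ht) ?_, ht.2.2⟩
  rintro rfl
  exact ht.2.2 hss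

/-- Just below `t₁` a semistable `F` of smaller rank destabilizes `E`. If it did so strictly after
`t₁`, its phase would meet that of `E` at some `s < t₁`. There `Z†_s(F)` is bounded and `q(F) ≥ 0`
by induction, so only finitely many classes occur, and none has a crossing close enough to `t₁`. So
`F` and `E` have equal phase at `t₁`. -/
theorem exists_wall [Module.Finite ℤ Γ] (hQ : σ.IsSupportForm Q) {δ : ℝ} (hδ : 0 < δ)
    (hrk : ∀ x : Γ, ∃ n : ℤ, σ.rk x = n * δ) {k₀ m : ℝ} (hk : B.NegDefBelow Q k₀) (hm : 0 < m)
    {t₁ : ℝ} (ht₁ : 0 < t₁) (hmt : m * t₁ < k₀) {E : D} (hr : 0 < σ.rk (cls cl E))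
    (hE : B.WeakSemistable t₁ E)
    (hun : ∀ a < t₁, ∃ t, a < t ∧ 0 < t ∧ t < t₁ ∧ ¬ B.WeakSemistable t E)
    (ih : ∀ t, 0 < t → t ≤ t₁ → ∀ F, B.WeakSemistable t F → σ.rk (cls cl F) < σ.rk (cls cl E) →
      0 ≤ B.mForm Q m (B.toVDag (cls cl F))) :
    ∃ (F G : D) (f : F ⟶ E) (g : E ⟶ G), IsShortExact σ.ADag f g ∧
      0 < σ.rk (cls cl F) ∧ 0 < σ.rk (cls cl G) ∧
      σ.rk (cls cl F) * B.reDag t₁ (cls cl E) = σ.rk (cls cl E) * B.reDag t₁ (cls cl F) := by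
  have := B.isTorsionFree_quotient_Γ₀Dag
  -- At a crossing, `rk F ≤ rk E` and proportionality give `|reDag s F| ≤ |reDag s E|`; `C` bounds
  -- both coordinates uniformly for `s ≤ t₁`.
  set C := σ.rk (cls cl E) + |σ.im (cls cl E)| + t₁ * |B.dI (cls cl E)| with hC
  have hfin := finite_lattice_of_bounded (B.mForm Q m) B.rkV B.imV B.dIV (t₁ / 2) t₁ C
    (fun s hs v h1 h2 hv => mForm_neg hk hm (by linarith [hs.1])
      ((mul_le_mul_of_nonneg_left hs.2 hm.le).trans_lt hmt)
      (Complex.ext ((B.ZDagBar_re s v).trans h2) ((B.ZDagBar_im s v).trans h1)) hv)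
  set X := {v : B.VDag | (∃ x : Γ ⧸ B.Γ₀Dag, v = 1 ⊗ₜ x) ∧ 0 ≤ B.mForm Q m v ∧
    ∃ s ∈ Set.Icc (t₁ / 2) t₁, |B.rkV v| ≤ C ∧ |B.imV v + s * B.dIV v| ≤ C} with hX
  let γ : B.VDag → ℝ → ℝ := fun v s => σ.rk (cls cl E) * (B.imV v + s * B.dIV v) -
    B.rkV v * B.reDag s (cls cl E)
  have hγc : ∀ v, Continuous (γ v) := fun v => by simp only [γ, reDag]; fun_prop
  have hγ : ∀ x s, γ (B.toVDag x) s =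
      σ.rk (cls cl E) * B.reDag s x - σ.rk x * B.reDag s (cls cl E) := fun x s => by
    simp only [γ, rkV_toVDag, imV_toVDag, dIV_toVDag]
    rfl
  have hev : ∀ᶠ s in nhds t₁, ∀ v ∈ X, 0 < γ v t₁ → 0 < γ v s := by
    refine (Filter.eventually_all_finite hfin).2 fun v _ => ?_
    by_cases h : 0 < γ v t₁
    · exact ((hγc v).continuousAt.eventually (lt_mem_nhds h)).mono fun s hs _ => hs
    · exact Filter.Eventually.of_forall fun s h' => absurd h' h
  obtain ⟨ε, hε, hball⟩ := Metric.eventually_nhds_iff.1 hev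
  obtain ⟨t, hat, ht0, ht, hns⟩ := hun (max (t₁ / 2) (t₁ - ε)) (max_lt (by linarith) (by linarith))
  obtain ⟨h2t, hεt⟩ := max_lt_iff.1 hat
  obtain ⟨F, G, f, g, hfg, hFss, hlt⟩ :=
    exists_weakSemistable_destabilizing hQ hδ hrk ht0 hE.1 hr hns
  have hc : cls cl E = cls cl F + cls cl G := by
    obtain ⟨-, -, -, _, hT⟩ := hfg
    exact cls_triangle hT
  have hrE : σ.rk (cls cl E) = σ.rk (cls cl F) + σ.rk (cls cl G) := by rw [hc, map_add]
  have hwall := hE.2 f g hfg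
  -- A rank-zero `F` compatible with semistability at `t₁` has `im = dI = 0`, hence cannot
  -- destabilize at any `t`.
  have hF0 : 0 < σ.rk (cls cl F) := by
    refine lt_of_le_of_ne (B.cls_of_ADag hQ hfg.1).1 fun h => ?_
    rw [← h, zero_mul] at hwall
    obtain ⟨h1, h2⟩ := B.im_dI_eq_zero hQ ht₁ hfg.1 h.symm (nonneg_of_mul_nonneg_right hwall hr)
    rw [← h, reDag, h1, h2] at hlt
    simp at hlt
  have hG0 : 0 < σ.rk (cls cl G) := by
    refine lt_of_le_of_ne (B.cls_of_ADag hQ hfg.2.2.1).1 fun h => ?_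
    have h1 := B.reDag_nonpos hQ ht0 hfg.2.2.1 h.symm
    have h2 : B.reDag t (cls cl E) = B.reDag t (cls cl F) + B.reDag t (cls cl G) := by
      rw [hc, reDag_add]
    rw [h2, hrE, ← h, add_zero] at hlt
    have := mul_nonpos_of_nonneg_of_nonpos hF0.le h1
    linarith
  refine ⟨F, G, f, g, hfg, hF0, hG0, le_antisymm hwall ?_⟩
  by_contra hne
  rw [not_le] at hne
  have hpos : 0 < γ (B.toVDag (cls cl F)) t₁ := by rw [hγ]; linarith
  have hneg : γ (B.toVDag (cls cl F)) t < 0 := by rw [hγ]; linarith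
  obtain ⟨s, hs, hs0⟩ := intermediate_value_Icc ht.le (hγc (B.toVDag (cls cl F))).continuousOn
    (show (0 : ℝ) ∈ _ from ⟨hneg.le, hpos.le⟩)
  have hsX : B.toVDag (cls cl F) ∈ X := by
    refine ⟨⟨_, rfl⟩, ih t ht0 ht.le F hFss (by linarith), s, ⟨by linarith [hs.1], hs.2⟩, ?_, ?_⟩
    · rw [rkV_toVDag, abs_of_pos hF0]
      have := abs_nonneg (σ.im (cls cl E))
      have := mul_nonneg ht₁.le (abs_nonneg (B.dI (cls cl E)))
      linarith
    · rw [imV_toVDag, dIV_toVDag]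
      change |B.reDag s (cls cl F)| ≤ C
      rw [hγ, sub_eq_zero] at hs0
      have h1 : σ.rk (cls cl E) * |B.reDag s (cls cl F)| ≤
          σ.rk (cls cl E) * |B.reDag s (cls cl E)| := by
        rw [← abs_of_pos hr, ← abs_mul, hs0, abs_mul, abs_of_pos hr, abs_of_pos hF0]
        exact mul_le_mul_of_nonneg_right (by linarith) (abs_nonneg _)
      refine (le_of_mul_le_mul_left h1 hr).trans ?_
      have h2 : |B.reDag s (cls cl E)| ≤ |σ.im (cls cl E)| + |s * B.dI (cls cl E)| :=
        abs_add_le _ _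
      have hs1 : 0 ≤ s := by linarith [hs.1]
      rw [abs_mul, abs_of_nonneg hs1] at h2
      have h3 := mul_le_mul_of_nonneg_right hs.2 (abs_nonneg (B.dI (cls cl E)))
      linarith
  have hd : dist s t₁ < ε := by
    rw [Real.dist_eq, abs_lt]
    constructor <;> linarith [hs.1, hs.2]
  exact absurd hs0 (hball hd _ hsX hpos).ne'

/-- Induction on the rank in units of `δ`. The parameter is quantified inside, since the pieces at a
wall are semistable only at a smaller parameter; `m` stays fixed and `m t < k₀` is preserved. -/
theorem mForm_nonneg [Module.Finite ℤ Γ] (hQ : σ.IsSupportForm Q) {δ : ℝ} (hδ : 0 < δ)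
    (hrk : ∀ x : Γ, ∃ n : ℤ, σ.rk x = n * δ) {k₀ m : ℝ} (hk : B.NegDefBelow Q k₀) (hm : 0 < m)
    (N : ℕ) : ∀ (E : D) (t₀ : ℝ), 0 < t₀ → m * t₀ < k₀ → B.WeakSemistable t₀ E →
      σ.rk (cls cl E) ≤ N * δ → 0 ≤ B.mForm Q m (B.toVDag (cls cl E)) := by
  induction N with
  | zero =>
    intro E t₀ ht₀ hmt hE hr
    rw [Nat.cast_zero, zero_mul] at hr
    obtain ⟨h1, h2⟩ := B.cls_of_ADag hQ hE.1
    have h0 := le_antisymm hr h1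
    obtain ⟨h3, h4, h5⟩ := h2 h0
    rw [mForm_toVDag, Δ_eq, h0]
    have := mul_nonneg_of_nonpos_of_nonpos h3 h4
    have := mul_nonneg hm.le h5
    linarith
  | succ N ihN =>
    intro E t₀ ht₀ hmt hE hr
    rcases le_or_gt (σ.rk (cls cl E)) (N * δ) with hle | hgt
    · exact ihN E t₀ ht₀ hmt hE hle
    have hlt : ∀ x : Γ, σ.rk x < σ.rk (cls cl E) → σ.rk x ≤ N * δ := by
      intro x hx
      obtain ⟨n, hn⟩ := hrk x
      rw [hn] at hx ⊢
      have h1 := lt_of_mul_lt_mul_right (hx.trans_le hr) hδ.le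
      have h2 : n < N + 1 := by exact_mod_cast h1
      have h3 : (n : ℝ) ≤ N := by exact_mod_cast Int.lt_add_one_iff.1 h2
      exact mul_le_mul_of_nonneg_right h3 hδ.le
    have hr0 : 0 < σ.rk (cls cl E) := lt_of_le_of_lt (by positivity) hgt
    by_cases hall : ∀ t, 0 < t → t ≤ t₀ → B.WeakSemistable t E
    · obtain ⟨h1, h2⟩ := nonneg_of_forall_weakSemistable hQ ht₀ hall hr0
      rw [mForm_toVDag]
      positivity
    push Not at hall
    obtain ⟨t₁, ht₁, ht₁₀, hE₁, hun⟩ := exists_last_unstable hE hall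
    have hmt' : ∀ t, t ≤ t₁ → m * t < k₀ := fun t ht =>
      (mul_le_mul_of_nonneg_left (ht.trans ht₁₀) hm.le).trans_lt hmt
    obtain ⟨F, G, f, g, hfg, hF0, hG0, hw⟩ := exists_wall hQ hδ hrk hk hm ht₁ (hmt' t₁ le_rfl) hr0
      hE₁ hun (fun t h1 h2 F hF hlF => ihN F t h1 (hmt' t h2) hF (hlt _ hlF))
    have hc : cls cl E = cls cl F + cls cl G := by
      obtain ⟨-, -, -, _, hT⟩ := hfg
      exact cls_triangle hT
    have hrE : σ.rk (cls cl E) = σ.rk (cls cl F) + σ.rk (cls cl G) := by rw [hc, map_add]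
    have hF := ihN F t₁ ht₁ (hmt' _ le_rfl) (hE₁.sub hfg hr0 hF0.le hw) (hlt _ (by linarith))
    have hG := ihN G t₁ ht₁ (hmt' _ le_rfl) (hE₁.quotient hfg hr0 hG0.le hw) (hlt _ (by linarith))
    rw [hc, toVDag_add]
    -- On the wall `Z†(F)` and `Z†(G)` lie on one ray, with ratio `rk F / rk G`.
    refine quadraticForm_add_nonneg _ (B.ZDagBar t₁)
      (fun x hx hx0 => mForm_neg hk hm ht₁ (hmt' _ le_rfl) hx hx0)
      (σ.rk (cls cl F) / σ.rk (cls cl G)) (by positivity) ?_ hF hG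
    rw [ZDagBar_toVDag, ZDagBar_toVDag]
    rw [hc, reDag_add, map_add] at hw
    apply Complex.ext
    · rw [Complex.smul_re, ZDag_re, ZDag_re, smul_eq_mul, div_mul_eq_mul_div, eq_div_iff hG0.ne']
      linarith
    · rw [Complex.smul_im, ZDag_im, ZDag_im, smul_eq_mul, div_mul_cancel₀ _ hG0.ne']

theorem Δkt_nonneg [Module.Finite ℤ Γ] (hQ : σ.IsSupportForm Q) (hgood : B.IsGood) {k₀ : ℝ}
    (hk₀ : B.NegDefBelow Q k₀) {k t : ℝ} (hk : k ∈ Set.Ioo 0 k₀) (ht : 0 < t) {E : D}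
    (hE : B.DagSemistable t E) : 0 ≤ B.Δkt Q k t (B.clDag E) := by
  obtain ⟨δ, hδ, hrk⟩ := exists_rk_discrete hgood.rational
  obtain ⟨n, hn⟩ := hrk (cls cl E)
  have hkt : k = k / t * t := by field_simp
  have h := mForm_nonneg hQ hδ hrk hk₀ (div_pos hk.1 ht) n.toNat E t ht (by rw [← hkt]; exact hk.2)
    (B.weakSemistable_of_dagSemistable hQ ht hE) (by
      rw [hn]
      exact mul_le_mul_of_nonneg_right (by exact_mod_cast Int.self_le_toNat n) hδ.le)
  rw [hkt, Δkt_eq_smul_mForm, smul_apply]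
  exact smul_nonneg ht.le h

end BGInequality

end VeryWeakPreStability

end VWStab

/-! ### The main theorem. -/

theorem mainTheorem6 {D : Type u} [CategoryTheory.Category.{v} D]
    [CategoryTheory.Preadditive D]
    [CategoryTheory.Limits.HasZeroObject D] [CategoryTheory.HasShift D ℤ]
    [∀ n : ℤ, (CategoryTheory.shiftFunctor D n).Additive] [CategoryTheory.Pretriangulated D]
    [CategoryTheory.IsTriangulated D]
    {Γ : Type w} [AddCommGroup Γ] [Module.Free ℤ Γ] [Module.Finite ℤ Γ]
    (cl : VWStab.K0 D →+ Γ) (σ : VWStab.VeryWeakPreStability cl)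
    (Q : QuadraticForm ℝ (ℝ ⊗[ℤ] (Γ ⧸ σ.Γ₀))) (hQ : σ.IsSupportForm Q)
    (B : σ.BGInequality) (hgood : B.IsGood) :
    (∃ k₀ : ℝ, 0 < k₀ ∧ B.NegDefBelow Q k₀) ∧
    (∀ k₀ : ℝ, B.NegDefBelow Q k₀ → ∀ k ∈ Set.Ioo 0 k₀, ∀ t : ℝ, 0 < t →
      ∀ E : D, B.DagSemistable t E → 0 ≤ B.Δkt Q k t (B.clDag E)) ∧
    (∀ t : ℝ, 0 < t → ∀ E : D, B.DagSemistable t E → 0 ≤ B.Δ (cl (VWStab.K0.of E))) := by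
  have hmain : ∀ k₀ : ℝ, B.NegDefBelow Q k₀ → ∀ k ∈ Set.Ioo 0 k₀, ∀ t : ℝ, 0 < t →
      ∀ E : D, B.DagSemistable t E → 0 ≤ B.Δkt Q k t (B.clDag E) :=
    fun k₀ hk₀ k hk t ht E hE => VWStab.VeryWeakPreStability.BGInequality.Δkt_nonneg hQ hgood hk₀
      hk ht hE
  obtain ⟨k₀, hk₀, hneg⟩ := B.exists_negDefBelow hQ
  refine ⟨⟨k₀, hk₀, hneg⟩, hmain, fun t ht E hE => ?_⟩
  by_contra hlt
  rw [not_le] at hlt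
  set q := Q (1 ⊗ₜ[ℤ] σ.Γ₀.mkQ (cl (VWStab.K0.of E)))
  set a := t * B.Δ (cl (VWStab.K0.of E))
  have ha : a < 0 := mul_neg_of_pos_of_neg ht hlt
  have hq : 0 < |q| + 1 := by positivity
  -- Part (c) uses (b) with `k` so small that `k q ≤ -a / 2`; then `k q + a < 0`, a contradiction.
  have hk : 0 < min (k₀ / 2) (-a / 2 / (|q| + 1)) :=
    lt_min (by linarith) (div_pos (by linarith) hq)
  have h := hmain k₀ hneg _ ⟨hk, (min_le_left _ _).trans_lt (by linarith)⟩ t ht E hE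
  rw [VWStab.VeryWeakPreStability.BGInequality.Δkt_clDag] at h
  have h1 := (le_div_iff₀ hq).1 (min_le_right (k₀ / 2) (-a / 2 / (|q| + 1)))
  have h2 := mul_le_mul_of_nonneg_left (show q ≤ |q| + 1 by linarith [le_abs_self q]) hk.le
  linarith
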